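/- Let $n>k\ge 2$ be integers, and let $\Sigma_n$ be the symmetric group on $[n]=\{1,\dots,n\}$. Let $\Pi_n$ be the lattice of set partitions of $[n]$, ordered so that the partition into singletons is the least element $\hat 0$ and the one-block partition is the greatest element $\hat 1$. The $k$-equal lattice $\Pi_{n,k}$ is the subposet of $\Pi_n$ consisting of all joins (including the empty join $\hat 0$) of partitions having a single nontrivial block, of size $k$. Its homology is the homology of the order complex $\Delta(\Pi_{n,k})$ of its proper part $\Pi_{n,k}\setminus\{\hat 0,\hat 1\}$. Consider finite rooted trees with $n$ leaves labelled by $1,\dots,n$, in which every non-leaf (including the root) has at least two children, up to root- and label-preserving isomorphism (combinatorial types). A preleaf is a non-leaf all of whose children are leaves; an internal edge is an edge not adjacent to a leaf. The complex of $k$-equal trees $T_{n,k}$ is the simplicial complex whose maximal simplices are the combinatorial types of those trees in which every preleaf has exactly $k$ children and every other non-leaf has exactly two children; the faces of the simplex of a tree $T$ are obtained by contracting internal edges of $T$. (Thus the vertices of the simplex of $T$ are the combinatorial types of the trees obtained from $T$ by contracting all internal edges but one.) The group $\Sigma_n$ acts on $T_{n,k}$ by permuting the leaf labels and on $\Pi_{n,k}$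 by permuting the elements of $[n]$. Then, for every commutative ring $R$ of coefficients (in particular $R=\mathbb{Z}$), the reduced homology groups of $T_{n,k}$ and of $\Pi_{n,k}$ are isomorphic as graded $\Sigma_n$-modules: in every degree $i$ there is an $R$-linear $\Sigma_n$-equivariant isomorphism \[ \widetilde H_i(T_{n,k};R)\;\cong_{\Sigma_n}\;\widetilde H_i(\Pi_{n,k};R). \] -/

import Mathlib

/-! ### Reduced simplicial homology as a representation -/

namespace SimplicialHomology

noncomputable section

/-- The subquotient `Z / B` of a module `M`, for submodules `B ≤ Z` (in general, `Z / (Z ∩ B)`). -/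
abbrev Subquotient {R M : Type*} [CommRing R] [AddCommGroup M] [Module R M]
    (Z B : Submodule R M) : Type _ :=
  Z ⧸ B.submoduleOf Z

/-- The representation induced on a subquotient by two invariant submodules. -/
def subquotientRep {R M G : Type*} [CommRing R] [AddCommGroup M] [Module R M] [Group G]
    (ρ : Representation R G M) (Z B : Submodule R M)
    (hZ : ∀ g, Z ≤ Z.comap (ρ g)) (hB : ∀ g, B ≤ B.comap (ρ g)) :
    Representation R G (Subquotient Z B) :=
  (ρ.subrepresentation Z hZ).quotient (B.submoduleOf Z) fun g _ hc => hB g hc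

/-- The alternating sum of the faces of a `(d+1)`-tuple of vertices, extended linearly. For `d = 0`
it sends every `1`-tuple to the empty tuple, i.e. it is the augmentation. -/
def boundary (R : Type*) [CommRing R] (V : Type*) (d : ℕ) :
    ((Fin (d + 1) → V) →₀ R) →ₗ[R] ((Fin d → V) →₀ R) :=
  Finsupp.linearCombination R fun t : Fin (d + 1) → V =>
    ∑ i : Fin (d + 1), (-1 : R) ^ (i : ℕ) • Finsupp.single (fun j => t (i.succAbove j)) (1 : R)

/-- The augmented ordered chains of a simplicial complex `K` in degree `d - 1`: the free module on
the `d`-tuples of vertices (repetitions allowed) that span a face of `K`; the empty tuple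
(the case `d = 0`) is always allowed, as it is the generator in degree `-1`. -/
def chains (R : Type*) [CommRing R] {V : Type*} (K : PreAbstractSimplicialComplex V) (d : ℕ) :
    Submodule R ((Fin d → V) →₀ R) :=
  Finsupp.supported R R
    {t | Set.range t = ∅ ∨ ∃ s ∈ K.faces, (s : Set V) = Set.range t}

/-- The cycles in degree `d - 1` of the augmented ordered chain complex. -/
def cycles (R : Type*) [CommRing R] {V : Type*} (K : PreAbstractSimplicialComplex V) :
    (d : ℕ) → Submodule R ((Fin d → V) →₀ R)
  | 0 => chains R K 0
  | d + 1 => chains R K (d + 1) ⊓ LinearMap.ker (boundary R V d)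

/-- The boundaries in degree `d - 1` of the augmented ordered chain complex. -/
def boundaries (R : Type*) [CommRing R] {V : Type*} (K : PreAbstractSimplicialComplex V) (d : ℕ) :
    Submodule R ((Fin d → V) →₀ R) :=
  (chains R K (d + 1)).map (boundary R V d)

/-- The reduced simplicial homology of `K` with coefficients in `R`, **in degree `d - 1`**
(so `d = 0` is degree `-1`, the lowest degree in which reduced homology can be nonzero). -/
abbrev ReducedHomology (R : Type*) [CommRing R] {V : Type*} (K : PreAbstractSimplicialComplex V)
    (d : ℕ) : Type _ :=
  Subquotient (cycles R K d) (boundaries R K d)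

/-- A simplicial complex is invariant under a group acting on its vertices. -/
def IsInvariant (G : Type*) [Group G] {V : Type*} [MulAction G V]
    (K : PreAbstractSimplicialComplex V) : Prop :=
  ∀ g : G, ∀ s ∈ K.faces, s.map (MulAction.toPerm g).toEmbedding ∈ K.faces

variable (R : Type*) [CommRing R] (G : Type*) [Group G] {V : Type*} [MulAction G V]

/-- The action of `G` on linear combinations of tuples, given by acting on all vertices. -/
def tupleRep (V : Type*) [MulAction G V] (d : ℕ) :
    Representation R G ((Fin d → V) →₀ R) where
  toFun g := Finsupp.lmapDomain R R (g • ·)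
  map_one' := by ext; simp
  map_mul' x y := by ext; simp [mul_smul]

variable {G}

theorem tupleRep_single {d : ℕ} (g : G) (t : Fin d → V) (r : R) :
    tupleRep R G V d g (Finsupp.single t r) = Finsupp.single (g • t) r := by
  simp [tupleRep]

theorem boundary_tupleRep {d : ℕ} (g : G) (c : (Fin (d + 1) → V) →₀ R) :
    boundary R V d (tupleRep R G V (d + 1) g c) = tupleRep R G V d g (boundary R V d c) := by
  suffices h : boundary R V d ∘ₗ tupleRep R G V (d + 1) g = tupleRep R G V d g ∘ₗ boundary R V d by
    exact LinearMap.congr_fun h c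
  refine Finsupp.lhom_ext fun t r => ?_
  simp only [LinearMap.comp_apply, tupleRep_single, boundary, Finsupp.linearCombination_single,
    map_smul, map_sum]
  rfl

variable {R} {K : PreAbstractSimplicialComplex V}

theorem chains_le_comap (hK : IsInvariant G K) (d : ℕ) (g : G) :
    chains R K d ≤ (chains R K d).comap (tupleRep R G V d g) := by
  rw [chains, Finsupp.supported_eq_span_single, Submodule.span_le]
  rintro _ ⟨t, ht, rfl⟩
  simp only [Submodule.comap_coe, Set.mem_preimage, tupleRep_single, SetLike.mem_coe]
  refine Submodule.subset_span ⟨g • t, ?_, rfl⟩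
  have hr : Set.range (g • t) = (g • ·) '' Set.range t := by
    rw [← Set.range_comp]; rfl
  rcases ht with ht | ⟨s, hs, hst⟩
  · left; rw [hr, ht, Set.image_empty]
  · right
    refine ⟨_, hK g s hs, ?_⟩
    rw [hr, ← hst]
    simp

theorem cycles_le_comap (hK : IsInvariant G K) (d : ℕ) (g : G) :
    cycles R K d ≤ (cycles R K d).comap (tupleRep R G V d g) := by
  cases d with
  | zero => exact chains_le_comap hK 0 g
  | succ d =>
    intro c hc
    refine ⟨chains_le_comap hK _ g hc.1, ?_⟩
    have h := hc.2
    simp only [SetLike.mem_coe, LinearMap.mem_ker] at h ⊢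
    rw [boundary_tupleRep, h, map_zero]

theorem boundaries_le_comap (hK : IsInvariant G K) (d : ℕ) (g : G) :
    boundaries R K d ≤ (boundaries R K d).comap (tupleRep R G V d g) := by
  rintro _ ⟨c, hc, rfl⟩
  exact ⟨_, chains_le_comap hK _ g hc, boundary_tupleRep R g c⟩

variable (R) (K)

/-- The representation of `G` on the reduced homology, in degree `d - 1`, of a `G`-invariant
simplicial complex: it is induced by the action of `G` on the vertices. -/
def reducedHomologyRep (hK : IsInvariant G K) (d : ℕ) :
    Representation R G (ReducedHomology R K d) :=
  subquotientRep (tupleRep R G V d) (cycles R K d) (boundaries R K d) (cycles_le_comap hK d)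
    (boundaries_le_comap hK d)

end

end SimplicialHomology

/-! ### The `k`-equal lattice -/

namespace KEqualLattice

/-- The order complex of a subset `S` of a poset: its faces are the nonempty finite chains
contained in `S`. -/
def orderComplex {P : Type*} [PartialOrder P] (S : Set P) : PreAbstractSimplicialComplex P where
  faces := {c | c.Nonempty ∧ (c : Set P) ⊆ S ∧ IsChain (· ≤ ·) (c : Set P)}
  isRelLowerSet_faces := fun _ hc =>
    ⟨hc.1, fun _ hb hne => ⟨hne, (Finset.coe_subset.2 hb).trans hc.2.1,
      hc.2.2.mono (Finset.coe_subset.2 hb)⟩⟩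

/-- The set partition `π` of `{1, …, n}` has exactly one nontrivial block, if `2 ≤ k`, and that
block has `k` elements. Set partitions are equivalence relations, and `π ≤ ρ` means that
`π` refines `ρ`, so `⊥` is the partition into singletons and `⊤` the one-block partition. -/
def IsSingleBlock {n : ℕ} (k : ℕ) (π : Setoid (Fin n)) : Prop :=
  ∃ B : Finset (Fin n), B.card = k ∧ ∀ x y, π x y ↔ x = y ∨ (x ∈ B ∧ y ∈ B)

/-- The `k`-equal lattice `Π_{n,k}`, as a subposet of the partition lattice: all joins (including
the empty join `⊥`) of partitions with a single nontrivial block, of size `k`. -/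
def kEqualLattice (n k : ℕ) : Set (Setoid (Fin n)) :=
  {π | ∃ A : Set (Setoid (Fin n)), (∀ ρ ∈ A, IsSingleBlock k ρ) ∧ sSup A = π}

/-- The proper part of the `k`-equal lattice: its least element is `⊥` and, for `2 ≤ k ≤ n`, its
greatest element is `⊤`. -/
def properPart (n k : ℕ) : Set (Setoid (Fin n)) :=
  {π | π ∈ kEqualLattice n k ∧ π ≠ ⊥ ∧ π ≠ ⊤}

/-- The symmetric group acts on set partitions: the blocks of `σ • π` are the images under `σ` of
the blocks of `π`. -/
instance permAction (n : ℕ) : MulAction (Equiv.Perm (Fin n)) (Setoid (Fin n)) where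
  smul σ π := Setoid.comap (fun x => σ⁻¹ x) π
  one_smul π := by
    ext x y
    exact Iff.rfl
  mul_smul σ τ π := by
    ext x y
    change π ((σ * τ)⁻¹ x) ((σ * τ)⁻¹ y) ↔ π (τ⁻¹ (σ⁻¹ x)) (τ⁻¹ (σ⁻¹ y))
    rw [mul_inv_rev]
    rfl

theorem smul_rel {n : ℕ} (σ : Equiv.Perm (Fin n)) (π : Setoid (Fin n)) (x y : Fin n) :
    (σ • π) x y ↔ π (σ⁻¹ x) (σ⁻¹ y) := Iff.rfl

theorem smul_mono {n : ℕ} (σ : Equiv.Perm (Fin n)) {π ρ : Setoid (Fin n)} (h : π ≤ ρ) :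
    σ • π ≤ σ • ρ := fun {_ _} hxy => h hxy

theorem smul_le_iff {n : ℕ} (σ : Equiv.Perm (Fin n)) {π ρ : Setoid (Fin n)} :
    σ • π ≤ ρ ↔ π ≤ σ⁻¹ • ρ :=
  ⟨fun h => by simpa using smul_mono σ⁻¹ h, fun h => by simpa using smul_mono σ h⟩

theorem smul_bot {n : ℕ} (σ : Equiv.Perm (Fin n)) : σ • (⊥ : Setoid (Fin n)) = ⊥ :=
  le_antisymm ((smul_le_iff σ).2 bot_le) bot_le

theorem smul_top {n : ℕ} (σ : Equiv.Perm (Fin n)) : σ • (⊤ : Setoid (Fin n)) = ⊤ :=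
  top_le_iff.1 (by simpa using (smul_le_iff σ⁻¹ (π := ⊤) (ρ := ⊤)).1 le_top)

theorem IsSingleBlock.smul {n k : ℕ} (σ : Equiv.Perm (Fin n)) {π : Setoid (Fin n)}
    (h : IsSingleBlock k π) : IsSingleBlock k (σ • π) := by
  obtain ⟨B, hB, h⟩ := h
  refine ⟨B.map σ.toEmbedding, by simpa using hB, fun x y => ?_⟩
  rw [smul_rel, h]
  simp [Finset.mem_map_equiv, Equiv.Perm.inv_def]

theorem smul_mem_properPart {n k : ℕ} (σ : Equiv.Perm (Fin n)) {π : Setoid (Fin n)}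
    (h : π ∈ properPart n k) : σ • π ∈ properPart n k := by
  obtain ⟨⟨A, hA, rfl⟩, hb, ht⟩ := h
  refine ⟨⟨(σ • ·) '' A, ?_, ?_⟩, ?_, ?_⟩
  · rintro _ ⟨ρ, hρ, rfl⟩
    exact (hA ρ hρ).smul σ
  · refine le_antisymm (sSup_le ?_) ((smul_le_iff σ).2 (sSup_le fun ρ hρ => ?_))
    · rintro _ ⟨ρ, hρ, rfl⟩
      exact smul_mono σ (le_sSup hρ)
    · exact (smul_le_iff σ).1 (le_sSup ⟨ρ, hρ, rfl⟩)
  · intro h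
    exact hb (by rw [← smul_bot σ] at h; exact MulAction.injective σ h)
  · intro h
    exact ht (by rw [← smul_top σ] at h; exact MulAction.injective σ h)

theorem orderComplex_isInvariant (n k : ℕ) :
    SimplicialHomology.IsInvariant (Equiv.Perm (Fin n)) (orderComplex (properPart n k)) := by
  rintro σ s ⟨hne, hs, hc⟩
  refine ⟨by simpa using hne, ?_, ?_⟩
  · intro π hπ
    simp only [Finset.coe_map, Set.mem_image] at hπ
    obtain ⟨ρ, hρ, rfl⟩ := hπ
    exact smul_mem_properPart σ (hs hρ)
  · rw [Finset.coe_map]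
    rintro _ ⟨π, hπ, rfl⟩ _ ⟨ρ, hρ, rfl⟩ _
    rcases hc.total hπ hρ with h | h
    · exact Or.inl (smul_mono σ h)
    · exact Or.inr (smul_mono σ h)

end KEqualLattice

/-! ### The complex of `k`-equal trees -/

namespace KEqualTree

/-- A finite rooted tree with `n` leaves labelled bijectively by `Fin n`, in which all non-leaves
(among them the root) have outdegree at least `2`. In Mathlib's `RootedTree`, the order is the
ancestor order: the root is `⊥`, the parent of `v` is `Order.pred v`, the children of `v` are the
`w` with `v ⋖ w`, and the leaves are the maximal elements. -/
structure LabelledTree (n : ℕ) where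
  tree : RootedTree.{0}
  finite : Finite tree
  leaf : Fin n ≃ {v : tree // IsMax v}
  root_not_leaf : ¬ IsMax (⊥ : tree)
  two_le_outdegree : ∀ v : tree, ¬ IsMax v → 2 ≤ {w : tree | v ⋖ w}.ncard

namespace LabelledTree

variable {n : ℕ}

/-- Two labelled rooted trees have the same combinatorial type: there is an isomorphism of rooted
trees that preserves the labels of the leaves. -/
def SameType (T S : LabelledTree n) : Prop :=
  ∃ e : T.tree ≃o S.tree, ∀ i, e (T.leaf i) = S.leaf i

instance typeSetoid (n : ℕ) : Setoid (LabelledTree n) where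
  r := SameType
  iseqv :=
    { refl := fun _ => ⟨OrderIso.refl _, fun _ => rfl⟩
      symm := fun ⟨e, he⟩ => ⟨e.symm, fun i => by rw [← he i]; simp⟩
      trans := fun ⟨e, he⟩ ⟨f, hf⟩ => ⟨e.trans f, fun i => by simp [he, hf]⟩ }

/-- The internal edges (those not adjacent to a leaf), an edge being named by its end farther from
the root: `v` stands for the edge between `v` and its parent. -/
def internalEdges (T : LabelledTree n) : Set T.tree :=
  {v | v ≠ ⊥ ∧ ¬ IsMax v}

/-- The map `f` from the vertices of `T` to the vertices of `S` exhibits `S` as obtained from `T` by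
contracting a set of internal edges (namely those `v` with `f (pred v) = f v`). -/
structure IsContractionMap (T S : LabelledTree n) (f : T.tree → S.tree) : Prop where
  surjective : Function.Surjective f
  map_root : f ⊥ = ⊥
  map_leaf : ∀ i, f (T.leaf i) = S.leaf i
  /-- Every edge of `T` is contracted to a point or mapped to an edge of `S`. -/
  edge : ∀ v, v ≠ ⊥ → f (Order.pred v) = f v ∨ f (Order.pred v) ⋖ f v
  /-- The edges adjacent to leaves are not contracted. -/
  leaf_edge : ∀ i, f (Order.pred (T.leaf i : T.tree)) ≠ f (T.leaf i)
  /-- The fibres of `f` are connected: with `u` and `v`, a fibre contains the vertex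
  of the path from `u` to `v` that is closest to the root. -/
  connected : ∀ u v, f u = f v → f (u ⊓ v) = f u

/-- `S` is obtained from `T` by contracting a (possibly empty) set of internal edges. -/
def ContractsTo (T S : LabelledTree n) : Prop :=
  ∃ f : T.tree → S.tree, IsContractionMap T S f

/-- A preleaf is a leaf of the rooted tree that remains after removing all leaves: a vertex that
is not a leaf and has no descendants other than leaves. -/
def IsPreleaf (T : LabelledTree n) (v : T.tree) : Prop :=
  Maximal (fun w : T.tree => ¬ IsMax w) v

/-- The tree is binary except at preleaves, where it is `k`-ary. -/
def IsKEqual (k : ℕ) (T : LabelledTree n) : Prop :=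
  ∀ v : T.tree, ¬ IsMax v →
    (T.IsPreleaf v → {w : T.tree | v ⋖ w}.ncard = k) ∧
    (¬ T.IsPreleaf v → {w : T.tree | v ⋖ w}.ncard = 2)

/-- Relabelling the leaves: the leaf with label `i` gets the label `σ i`. -/
def relabel (σ : Equiv.Perm (Fin n)) (T : LabelledTree n) : LabelledTree n :=
  { T with leaf := σ.symm.trans T.leaf }

theorem SameType.relabel (σ : Equiv.Perm (Fin n)) {T S : LabelledTree n} (h : SameType T S) :
    SameType (T.relabel σ) (S.relabel σ) := by
  obtain ⟨e, he⟩ := h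
  exact ⟨e, fun i => he (σ.symm i)⟩

theorem ContractsTo.relabel (σ : Equiv.Perm (Fin n)) {T S : LabelledTree n} (h : ContractsTo T S) :
    ContractsTo (T.relabel σ) (S.relabel σ) := by
  obtain ⟨f, hf⟩ := h
  exact ⟨f, hf.surjective, hf.map_root, fun i => hf.map_leaf (σ.symm i), hf.edge,
    fun i => hf.leaf_edge (σ.symm i), hf.connected⟩

end LabelledTree

open LabelledTree

/-- Combinatorial types of rooted trees with `n` labelled leaves. -/
abbrev TreeType (n : ℕ) : Type 1 := Quotient (LabelledTree.typeSetoid n)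

/-- The simplex of `T`. Its vertices correspond to the internal edges of `T`: they are the
combinatorial types of the trees with exactly one internal edge that are obtained from `T` by
contracting all but one of its internal edges. -/
def simplex {n : ℕ} (T : LabelledTree n) : Set (TreeType n) :=
  {c | ∃ S : LabelledTree n, c = Quotient.mk _ S ∧ S.internalEdges.ncard = 1 ∧ T.ContractsTo S}

/-- The complex of `k`-equal trees `T_{n,k}`: the simplicial complex generated by the simplices of
the trees that are binary except at preleaves, where they are `k`-ary. Passing to the face
of the simplex of `T` on some of the internal edges of `T` amounts to contracting the other
internal edges of `T`. -/
def kEqualTreeComplex (n k : ℕ) : PreAbstractSimplicialComplex (TreeType n) where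
  faces := {s | s.Nonempty ∧
    ∃ T : LabelledTree n, T.IsKEqual k ∧ (s : Set (TreeType n)) ⊆ simplex T}
  isRelLowerSet_faces := fun _ hs =>
    ⟨hs.1, fun _ hb hne => ⟨hne, hs.2.choose, hs.2.choose_spec.1,
      (Finset.coe_subset.2 hb).trans hs.2.choose_spec.2⟩⟩

/-- The symmetric group acts on combinatorial types of trees by permuting the labels. -/
instance permAction (n : ℕ) : MulAction (Equiv.Perm (Fin n)) (TreeType n) where
  smul σ := Quotient.map (LabelledTree.relabel σ) fun _ _ h => SameType.relabel σ h
  one_smul c := by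
    induction c using Quotient.inductionOn with
    | h T => rfl
  mul_smul σ τ c := by
    induction c using Quotient.inductionOn with
    | h T => rfl

theorem kEqualTreeComplex_isInvariant (n k : ℕ) :
    SimplicialHomology.IsInvariant (Equiv.Perm (Fin n)) (kEqualTreeComplex n k) := by
  rintro σ s ⟨hne, T, hT, hs⟩
  refine ⟨by simpa using hne, T.relabel σ, hT, ?_⟩
  intro c hc
  simp only [Finset.coe_map, Set.mem_image] at hc
  obtain ⟨b, hb, rfl⟩ := hc
  obtain ⟨S, rfl, hS, hTS⟩ := hs hb
  exact ⟨S.relabel σ, rfl, hS, hTS.relabel σ⟩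

end KEqualTree

/-! The argument is an acyclic-carrier comparison over the partition lattice, made equivariant after
the fact.

A vertex of the tree complex is a tree with one internal edge, hence amounts to one subset `A` of
`[n]` (the leaves beyond that edge), and is labelled by the partition `block A`. A vertex of the
order complex is labelled by itself. In both complexes the labels on a nonempty face have their join
in the proper part of the `k`-equal lattice, and for every `q` in the proper part the faces with all
labels below `q` form a cone (`IsConeFamily`). In the order complex the apex is `q`; in the tree
complex it is a tree whose only internal edge cuts off a proper class of `q` with at least `k`
elements.

Coning degree by degree yields label-respecting chain maps in both directions, and any two such maps
are chain homotopic (`isCarried_carrierMap`, `IsCarried.sub_mem_boundaries`). The composites are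
therefore homotopic to the identity. Apexes are chosen with no regard to the group, but the
conjugate of a carried map by a permutation is again carried, hence homotopic to it; on homology the
map commutes with the action (`nonempty_equiv_of_isConeFamily`).

The cone property for trees rests on a dictionary: a tree is its laminar family of clusters,
contraction is inclusion of families (`contractsTo_iff_edgeClusters_subset`), and every laminar
family of proper subsets of size at least `k` sits inside a `k`-equal tree (`exists_isKEqual`).
Faces thus become laminar families, and a class of `q` is laminar with every set contained in a
class of `q`. -/

namespace SimplicialHomology

noncomputable section

/-! ### Ordered chains: cones and the boundary operator. -/

section Boundary

variable (R : Type*) [CommRing R] {V W : Type*}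

/-- A tuple of vertices is a face tuple of `K` if it is empty or its entries span a face. -/
def IsFaceTuple (K : PreAbstractSimplicialComplex V) {d : ℕ} (t : Fin d → V) : Prop :=
  Set.range t = ∅ ∨ ∃ s ∈ K.faces, (s : Set V) = Set.range t

theorem IsFaceTuple.comp {K : PreAbstractSimplicialComplex V} {d e : ℕ} {t : Fin d → V}
    (h : IsFaceTuple K t) (f : Fin e → Fin d) : IsFaceTuple K (t ∘ f) := by
  classical
  rcases Set.eq_empty_or_nonempty (Set.range (t ∘ f)) with h0 | h0
  · exact Or.inl h0
  · right
    have hsub : Set.range (t ∘ f) ⊆ Set.range t := Set.range_comp_subset_range f t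
    rcases h with h | ⟨s, hs, hst⟩
    · rw [h, Set.subset_empty_iff] at hsub
      exact absurd hsub h0.ne_empty
    · refine ⟨Finset.univ.image (t ∘ f), (K.isRelLowerSet_faces hs).2 ?_ ?_,
        by rw [Finset.coe_image, Finset.coe_univ, Set.image_univ]⟩
      · rwa [← Finset.coe_subset, hst, Finset.coe_image, Finset.coe_univ, Set.image_univ]
      · rwa [← Finset.coe_nonempty, Finset.coe_image, Finset.coe_univ, Set.image_univ]

/-- The cone operator on chains: it puts the vertex `v` in front of each tuple. -/
def cone (v : V) (d : ℕ) : ((Fin d → V) →₀ R) →ₗ[R] ((Fin (d + 1) → V) →₀ R) :=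
  Finsupp.lmapDomain R R fun t => Fin.cons v t

variable {R}

theorem cone_single (v : V) {d : ℕ} (t : Fin d → V) (r : R) :
    cone R v d (Finsupp.single t r) = Finsupp.single (Fin.cons v t) r := by
  simp [cone]

theorem boundary_single {d : ℕ} (t : Fin (d + 1) → V) (r : R) :
    boundary R V d (Finsupp.single t r) =
      r • ∑ i : Fin (d + 1), (-1 : R) ^ (i : ℕ) • Finsupp.single (t ∘ i.succAbove) (1 : R) := by
  simp only [boundary, Finsupp.linearCombination_single]
  rfl

theorem boundary_cone_zero (v : V) (c : (Fin 0 → V) →₀ R) :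
    boundary R V 0 (cone R v 0 c) = c := by
  suffices h : boundary R V 0 ∘ₗ cone R v 0 = LinearMap.id from LinearMap.congr_fun h c
  refine Finsupp.lhom_ext fun t r => ?_
  simp only [LinearMap.comp_apply, cone_single, boundary_single, LinearMap.id_apply]
  simp [Subsingleton.elim _ t]

/-- Deleting the apex returns the tuple itself; deleting any later entry commutes with coning, but
its index has shifted by one, which flips the sign. So coning is a contracting homotopy. -/
theorem boundary_cone_succ (v : V) {d : ℕ} (c : (Fin (d + 1) → V) →₀ R) :
    boundary R V (d + 1) (cone R v (d + 1) c) = c - cone R v d (boundary R V d c) := by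
  suffices h : boundary R V (d + 1) ∘ₗ cone R v (d + 1) =
      LinearMap.id - cone R v d ∘ₗ boundary R V d from LinearMap.congr_fun h c
  refine Finsupp.lhom_ext fun t r => ?_
  simp only [LinearMap.comp_apply, LinearMap.sub_apply, cone_single, boundary_single,
    LinearMap.id_apply, map_smul, map_sum]
  rw [Fin.sum_univ_succ, smul_add, sub_eq_add_neg, ← smul_neg, ← Finset.sum_neg_distrib]
  congr 1
  · have : (Fin.cons v t : Fin (d + 2) → V) ∘ Fin.succAbove 0 = t := by
      ext j; simp
    rw [this]
    simp
  · congr 1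
    refine Finset.sum_congr rfl fun i _ => ?_
    have : (Fin.cons v t : Fin (d + 2) → V) ∘ i.succ.succAbove =
        Fin.cons v (t ∘ i.succAbove) := by
      ext j
      refine Fin.cases ?_ (fun j => ?_) j <;> simp
    rw [this]
    simp [pow_succ]

/-- Every nonempty tuple is the cone over its tail from its head, so the cone formula gives this by
induction, without pairing off terms of a double sum. -/
theorem boundary_boundary {d : ℕ} (c : (Fin (d + 2) → V) →₀ R) :
    boundary R V d (boundary R V (d + 1) c) = 0 := by
  suffices h : boundary R V d ∘ₗ boundary R V (d + 1) = 0 from LinearMap.congr_fun h c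
  clear c
  induction d with
  | zero =>
    refine Finsupp.lhom_ext fun t r => ?_
    rw [← Fin.cons_self_tail t, ← cone_single]
    simp [boundary_cone_succ, boundary_cone_zero]
  | succ d ih =>
    refine Finsupp.lhom_ext fun t r => ?_
    have h := LinearMap.congr_fun ih (Finsupp.single (Fin.tail t) r)
    simp only [LinearMap.comp_apply, LinearMap.zero_apply] at h
    rw [← Fin.cons_self_tail t, ← cone_single]
    simp [boundary_cone_succ, h]

end Boundary

/-! ### Acyclic carriers for labelled complexes. -/

section Carrier

variable {R : Type*} [CommRing R] {V W U P : Type*} [CompleteLattice P]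

/-- A family of cones in a labelled simplicial complex: the labels of the entries of a nonempty face
tuple have their supremum in `Q`, and for every `q ∈ Q` the faces with labels at most `q` form
a cone with vertex `apex q`. -/
structure IsConeFamily (K : PreAbstractSimplicialComplex V) (α : V → P) (Q : Set P)
    (apex : P → V) : Prop where
  iSup_mem : ∀ {d : ℕ} (t : Fin (d + 1) → V), IsFaceTuple K t → ⨆ j, α (t j) ∈ Q
  apex_le : ∀ q ∈ Q, α (apex q) ≤ q
  cons_mem : ∀ q ∈ Q, ∀ {d : ℕ} (t : Fin d → V), IsFaceTuple K t → (∀ j, α (t j) ≤ q) →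
    IsFaceTuple K (Fin.cons (apex q) t : Fin (d + 1) → V)

variable (R) in
/-- The chains on the face tuples with all labels at most `q`. -/
def chainsBelow (K : PreAbstractSimplicialComplex V) (α : V → P) (q : P) (d : ℕ) :
    Submodule R ((Fin d → V) →₀ R) :=
  Finsupp.supported R R {t | IsFaceTuple K t ∧ ∀ j, α (t j) ≤ q}

variable {K : PreAbstractSimplicialComplex V} {L : PreAbstractSimplicialComplex W}
  {N : PreAbstractSimplicialComplex U}
  {α : V → P} {β : W → P} {γ : U → P} {Q : Set P} {apex : P → W}

theorem single_mem_chainsBelow {q : P} {d : ℕ} {t : Fin d → V} (h : IsFaceTuple K t)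
    (hq : ∀ j, α (t j) ≤ q) (r : R) : Finsupp.single t r ∈ chainsBelow R K α q d :=
  Finsupp.single_mem_supported R r ⟨h, hq⟩

theorem single_mem_chains {d : ℕ} {t : Fin d → V} (h : IsFaceTuple K t) (r : R) :
    Finsupp.single t r ∈ chains R K d :=
  Finsupp.single_mem_supported R r h

theorem chainsBelow_le_iff {q : P} {d : ℕ} {S : Submodule R ((Fin d → V) →₀ R)} :
    chainsBelow R K α q d ≤ S ↔
      ∀ t : Fin d → V, IsFaceTuple K t → (∀ j, α (t j) ≤ q) → Finsupp.single t 1 ∈ S := by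
  rw [chainsBelow, Finsupp.supported_eq_span_single, Submodule.span_le]
  constructor
  · exact fun h t ht hq => h ⟨t, ⟨ht, hq⟩, rfl⟩
  · rintro h _ ⟨t, ⟨ht, hq⟩, rfl⟩
    exact h t ht hq

theorem chains_le_iff {d : ℕ} {S : Submodule R ((Fin d → V) →₀ R)} :
    chains R K d ≤ S ↔ ∀ t : Fin d → V, IsFaceTuple K t → Finsupp.single t 1 ∈ S := by
  rw [chains, Finsupp.supported_eq_span_single, Submodule.span_le]
  constructor
  · exact fun h t ht => h ⟨t, ht, rfl⟩
  · rintro h _ ⟨t, ht, rfl⟩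
    exact h t ht

theorem chainsBelow_le_chains (q : P) (d : ℕ) : chainsBelow R K α q d ≤ chains R K d :=
  chainsBelow_le_iff.2 fun _ ht _ => single_mem_chains ht 1

theorem chainsBelow_mono {p q : P} (h : p ≤ q) (d : ℕ) :
    chainsBelow R K α p d ≤ chainsBelow R K α q d :=
  chainsBelow_le_iff.2 fun _ ht hp => single_mem_chainsBelow ht (fun j => (hp j).trans h) 1

theorem chainsBelow_le_comap_boundary (q : P) (d : ℕ) :
    chainsBelow R K α q (d + 1) ≤ (chainsBelow R K α q d).comap (boundary R V d) := by
  refine chainsBelow_le_iff.2 fun t ht hq => ?_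
  rw [Submodule.mem_comap, boundary_single]
  exact Submodule.smul_mem _ _ (Submodule.sum_mem _ fun i _ => Submodule.smul_mem _ _
    (single_mem_chainsBelow (ht.comp _) (fun j => hq _) 1))

theorem chainsBelow_le_comap_cone (hL : IsConeFamily L β Q apex) {q : P} (hq : q ∈ Q) (d : ℕ) :
    chainsBelow R L β q d ≤ (chainsBelow R L β q (d + 1)).comap (cone R (apex q) d) := by
  refine chainsBelow_le_iff.2 fun t ht htq => ?_
  rw [Submodule.mem_comap, cone_single]
  refine single_mem_chainsBelow (hL.cons_mem q hq t ht htq) (fun j => ?_) 1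
  refine Fin.cases ?_ (fun j => ?_) j
  · simpa using hL.apex_le q hq
  · simpa using htq j

/-- A chain map, compatible with the augmentation, that is carried by the labels. -/
structure IsCarried (K : PreAbstractSimplicialComplex V) (α : V → P)
    (L : PreAbstractSimplicialComplex W) (β : W → P) (Q : Set P)
    (f : ∀ d, ((Fin d → V) →₀ R) →ₗ[R] ((Fin d → W) →₀ R)) : Prop where
  zero : ∀ r, f 0 (Finsupp.single Fin.elim0 r) = Finsupp.single Fin.elim0 r
  comm : ∀ d c, boundary R W d (f (d + 1) c) = f d (boundary R V d c)
  carried : ∀ q ∈ Q, ∀ d, chainsBelow R K α q d ≤ (chainsBelow R L β q d).comap (f d)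

/-- A nonempty face tuple lies below the join of its own labels, and that join belongs to `Q`;
control over each `q ∈ Q` is thus control over all chains of positive length. -/
theorem le_comap_chains_of_chainsBelow {apexK : P → V} (hK : IsConeFamily K α Q apexK) {d e : ℕ}
    {f : ((Fin (d + 1) → V) →₀ R) →ₗ[R] ((Fin e → W) →₀ R)}
    (hf : ∀ q ∈ Q, chainsBelow R K α q (d + 1) ≤ (chainsBelow R L β q e).comap f) :
    chains R K (d + 1) ≤ (chains R L e).comap f :=
  chains_le_iff.2 fun t ht => chainsBelow_le_chains _ _
    (hf _ (hK.iSup_mem t ht) (single_mem_chainsBelow ht (fun j => le_iSup (fun j => α (t j)) j) 1))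

variable {f g : ∀ d, ((Fin d → V) →₀ R) →ₗ[R] ((Fin d → W) →₀ R)}
  {h : ∀ d, ((Fin d → W) →₀ R) →ₗ[R] ((Fin d → U) →₀ R)}

namespace IsCarried

theorem id : IsCarried (R := R) K α K α Q (fun _ => LinearMap.id) :=
  ⟨fun _ => rfl, fun _ _ => rfl, fun _ _ _ => le_rfl⟩

theorem comp (hh : IsCarried L β N γ Q h) (hf : IsCarried K α L β Q f) :
    IsCarried K α N γ Q (fun d => h d ∘ₗ f d) :=
  ⟨fun r => by simp [hf.zero, hh.zero], fun d c => by simp [hf.comm, hh.comm],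
    fun q hq d => (hf.carried q hq d).trans (Submodule.comap_mono (hh.carried q hq d))⟩

theorem zero_eq (hf : IsCarried K α L β Q f) (hg : IsCarried K α L β Q g) : f 0 = g 0 := by
  refine Finsupp.lhom_ext fun t r => ?_
  rw [Subsingleton.elim t Fin.elim0, hf.zero, hg.zero]

theorem chains_le_comap {apexK : P → V} (hK : IsConeFamily K α Q apexK)
    (hf : IsCarried K α L β Q f) (d : ℕ) : chains R K d ≤ (chains R L d).comap (f d) := by
  cases d with
  | zero =>
    refine chains_le_iff.2 fun t ht => ?_
    rw [Submodule.mem_comap, Subsingleton.elim t Fin.elim0, hf.zero]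
    exact single_mem_chains (Or.inl (Set.range_eq_empty _)) 1
  | succ d => exact le_comap_chains_of_chainsBelow hK fun q hq => hf.carried q hq (d + 1)

theorem cycles_le_comap {apexK : P → V} (hK : IsConeFamily K α Q apexK)
    (hf : IsCarried K α L β Q f) (d : ℕ) : cycles R K d ≤ (cycles R L d).comap (f d) := by
  cases d with
  | zero => exact hf.chains_le_comap hK 0
  | succ d =>
    intro c hc
    have hz := hc.2
    rw [SetLike.mem_coe, LinearMap.mem_ker] at hz
    refine ⟨hf.chains_le_comap hK _ hc.1, ?_⟩
    simp [hf.comm, hz]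

theorem boundaries_le_comap {apexK : P → V} (hK : IsConeFamily K α Q apexK)
    (hf : IsCarried K α L β Q f) (d : ℕ) :
    boundaries R K d ≤ (boundaries R L d).comap (f d) := by
  rintro _ ⟨c, hc, rfl⟩
  exact ⟨f (d + 1) c, hf.chains_le_comap hK _ hc, hf.comm d c⟩

end IsCarried

variable (R α apex) in
/-- The chain map built, degree by degree, from the cones in the target. -/
def carrierMap : ∀ d, ((Fin d → V) →₀ R) →ₗ[R] ((Fin d → W) →₀ R)
  | 0 => Finsupp.lmapDomain R R fun _ => Fin.elim0
  | d + 1 => Finsupp.linearCombination R fun t : Fin (d + 1) → V =>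
      cone R (apex (⨆ j, α (t j))) d (carrierMap d (boundary R V d (Finsupp.single t 1)))

theorem carrierMap_succ_single {d : ℕ} (t : Fin (d + 1) → V) :
    carrierMap R α apex (d + 1) (Finsupp.single t 1) =
      cone R (apex (⨆ j, α (t j))) d
        (carrierMap R α apex d (boundary R V d (Finsupp.single t 1))) := by
  simp [carrierMap]

/-- This is purely formal: the error term in the cone formula is the cone over the image of `∂∂t`,
which vanishes. No property of the apexes is needed. -/
theorem boundary_carrierMap (d : ℕ) (c : (Fin (d + 1) → V) →₀ R) :
    boundary R W d (carrierMap R α apex (d + 1) c) =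
      carrierMap R α apex d (boundary R V d c) := by
  suffices h : boundary R W d ∘ₗ carrierMap R α apex (d + 1) =
      carrierMap R α apex d ∘ₗ boundary R V d from LinearMap.congr_fun h c
  clear c
  induction d with
  | zero =>
    refine Finsupp.lhom_ext' fun t => LinearMap.ext_ring ?_
    simp only [LinearMap.comp_apply, Finsupp.lsingle_apply, carrierMap_succ_single,
      boundary_cone_zero]
  | succ d ih =>
    refine Finsupp.lhom_ext' fun t => LinearMap.ext_ring ?_
    have h := LinearMap.congr_fun ih
      (boundary R V (d + 1) (Finsupp.single t 1))
    simp only [LinearMap.comp_apply] at h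
    simp only [LinearMap.comp_apply, Finsupp.lsingle_apply, carrierMap_succ_single,
      boundary_cone_succ, h, boundary_boundary, map_zero, sub_zero]

/-- The apex used for `t` belongs to the join of the labels of `t`, the smallest admissible bound.
The image therefore stays below that join, and so below every other bound of `t`. -/
theorem isCarried_carrierMap {apexK : P → V} (hK : IsConeFamily K α Q apexK)
    (hL : IsConeFamily L β Q apex) : IsCarried K α L β Q (carrierMap R α apex) where
  zero r := by simp [carrierMap]
  comm := boundary_carrierMap
  carried q hq d := by
    induction d generalizing q with
    | zero =>
      refine chainsBelow_le_iff.2 fun t _ _ => ?_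
      simp only [Submodule.mem_comap, carrierMap, Finsupp.lmapDomain_apply,
        Finsupp.mapDomain_single]
      exact single_mem_chainsBelow (Or.inl (Set.range_eq_empty _)) (fun j => j.elim0) 1
    | succ d ih =>
      refine chainsBelow_le_iff.2 fun t ht htq => ?_
      have hmem := hK.iSup_mem t ht
      rw [Submodule.mem_comap, carrierMap_succ_single]
      refine chainsBelow_mono (iSup_le htq) _ (chainsBelow_le_comap_cone hL hmem d
        (ih _ hmem (chainsBelow_le_comap_boundary _ d ?_)))
      exact single_mem_chainsBelow ht (fun j => le_iSup (fun j => α (t j)) j) 1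

variable (α apex f g) in
/-- The chain homotopy between two chain maps, built from the cones in the target. -/
def carrierHomotopy : ∀ d, ((Fin d → V) →₀ R) →ₗ[R] ((Fin (d + 1) → W) →₀ R)
  | 0 => 0
  | d + 1 => Finsupp.linearCombination R fun t : Fin (d + 1) → V =>
      cone R (apex (⨆ j, α (t j))) (d + 1)
        (f (d + 1) (Finsupp.single t 1) - g (d + 1) (Finsupp.single t 1) -
          carrierHomotopy d (boundary R V d (Finsupp.single t 1)))

theorem carrierHomotopy_succ_single {d : ℕ} (t : Fin (d + 1) → V) :
    carrierHomotopy α apex f g (d + 1) (Finsupp.single t 1) =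
      cone R (apex (⨆ j, α (t j))) (d + 1)
        (f (d + 1) (Finsupp.single t 1) - g (d + 1) (Finsupp.single t 1) -
          carrierHomotopy α apex f g d (boundary R V d (Finsupp.single t 1))) := by
  simp [carrierHomotopy]

/-- By induction `f t - g t - h(∂t)` is a cycle, so taking the boundary of its cone recovers it. The
recursion may start from zero because `f` and `g` agree on the empty tuple. -/
theorem boundary_carrierHomotopy (hf : IsCarried K α L β Q f) (hg : IsCarried K α L β Q g) (d : ℕ)
    (c : (Fin (d + 1) → V) →₀ R) :
    boundary R W (d + 1) (carrierHomotopy α apex f g (d + 1) c) =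
      f (d + 1) c - g (d + 1) c - carrierHomotopy α apex f g d (boundary R V d c) := by
  suffices h : boundary R W (d + 1) ∘ₗ carrierHomotopy α apex f g (d + 1) =
      f (d + 1) - g (d + 1) - carrierHomotopy α apex f g d ∘ₗ boundary R V d from
    LinearMap.congr_fun h c
  clear c
  induction d with
  | zero =>
    refine Finsupp.lhom_ext' fun t => LinearMap.ext_ring ?_
    simp [boundary_cone_succ, hf.comm, hg.comm, hf.zero_eq hg, carrierHomotopy]
  | succ d ih =>
    refine Finsupp.lhom_ext' fun t => LinearMap.ext_ring ?_
    have h := LinearMap.congr_fun ih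
      (boundary R V (d + 1) (Finsupp.single t 1))
    simp only [LinearMap.comp_apply, LinearMap.sub_apply] at h
    simp [carrierHomotopy_succ_single, boundary_cone_succ, hf.comm, hg.comm, h, boundary_boundary]
    abel

theorem carrierHomotopy_carried {apexK : P → V} (hK : IsConeFamily K α Q apexK)
    (hL : IsConeFamily L β Q apex) (hf : IsCarried K α L β Q f) (hg : IsCarried K α L β Q g)
    (d : ℕ) : ∀ q ∈ Q, chainsBelow R K α q d ≤
      (chainsBelow R L β q (d + 1)).comap (carrierHomotopy α apex f g d) := by
  induction d with
  | zero => exact fun q _ c _ => (chainsBelow R L β q 1).zero_mem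
  | succ d ih =>
    refine fun q hq => chainsBelow_le_iff.2 fun t ht htq => ?_
    have hmem := hK.iSup_mem t ht
    have hs : Finsupp.single t (1 : R) ∈ chainsBelow R K α (⨆ j, α (t j)) (d + 1) :=
      single_mem_chainsBelow ht (fun j => le_iSup (fun j => α (t j)) j) 1
    rw [Submodule.mem_comap, carrierHomotopy_succ_single]
    refine chainsBelow_mono (iSup_le htq) _ (chainsBelow_le_comap_cone hL hmem (d + 1) ?_)
    exact Submodule.sub_mem _ (Submodule.sub_mem _ (hf.carried _ hmem _ hs)
      (hg.carried _ hmem _ hs)) (ih _ hmem (chainsBelow_le_comap_boundary _ d hs))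

/-- Two carried chain maps differ on cycles by boundaries. -/
theorem IsCarried.sub_mem_boundaries {apexK : P → V} (hK : IsConeFamily K α Q apexK)
    (hL : IsConeFamily L β Q apex) (hf : IsCarried K α L β Q f) (hg : IsCarried K α L β Q g)
    (d : ℕ) {z : (Fin d → V) →₀ R} (hz : z ∈ cycles R K d) :
    f d z - g d z ∈ boundaries R L d := by
  cases d with
  | zero => rw [hf.zero_eq hg, sub_self]; exact Submodule.zero_mem _
  | succ d =>
    have hz0 := hz.2
    rw [SetLike.mem_coe, LinearMap.mem_ker] at hz0
    refine ⟨carrierHomotopy α apex f g (d + 1) z, le_comap_chains_of_chainsBelow hK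
      (carrierHomotopy_carried hK hL hf hg (d + 1)) hz.1, ?_⟩
    rw [boundary_carrierHomotopy hf hg, hz0, map_zero, sub_zero]

end Carrier

/-! ### Induced maps on homology and equivariance. -/

section Homology

variable {R : Type*} [CommRing R]

/-- The linear map on subquotients induced by a linear map. -/
def Subquotient.map {M M' : Type*} [AddCommGroup M] [Module R M] [AddCommGroup M'] [Module R M']
    {Z B : Submodule R M} {Z' B' : Submodule R M'} (f : M →ₗ[R] M') (hZ : Z ≤ Z'.comap f)
    (hB : B ≤ B'.comap f) : Subquotient Z B →ₗ[R] Subquotient Z' B' :=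
  Submodule.mapQ _ _ (f.restrict hZ) fun _ hc => hB hc

theorem Subquotient.mk_eq_mk {M : Type*} [AddCommGroup M] [Module R M] {Z B : Submodule R M}
    {x y : Z} (h : (x : M) - y ∈ B) :
    (Submodule.Quotient.mk x : Subquotient Z B) = Submodule.Quotient.mk y :=
  (Submodule.Quotient.eq _).2 h

variable {G V W P : Type*} [Group G] [MulAction G V] [MulAction G W] [CompleteLattice P]
  [MulAction G P]
  {K : PreAbstractSimplicialComplex V} {L : PreAbstractSimplicialComplex W}
  {α : V → P} {β : W → P} {Q : Set P}

theorem IsFaceTuple.smul (hK : IsInvariant G K) (g : G) {d : ℕ} {t : Fin d → V}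
    (ht : IsFaceTuple K t) : IsFaceTuple K (g • t) := by
  have hr : Set.range (g • t) = (g • ·) '' Set.range t := by
    rw [← Set.range_comp]; rfl
  rcases ht with ht | ⟨s, hs, hst⟩
  · left; rw [hr, ht, Set.image_empty]
  · right
    refine ⟨_, hK g s hs, ?_⟩
    rw [hr, ← hst]
    simp

theorem chainsBelow_le_comap_tupleRep (hmono : ∀ (g : G) {p q : P}, p ≤ q → g • p ≤ g • q)
    (hα : ∀ (g : G) v, α (g • v) = g • α v) (hK : IsInvariant G K) (g : G) (q : P) (d : ℕ) :
    chainsBelow R K α q d ≤ (chainsBelow R K α (g • q) d).comap (tupleRep R G V d g) := by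
  refine chainsBelow_le_iff.2 fun t ht htq => ?_
  rw [Submodule.mem_comap, tupleRep_single]
  refine single_mem_chainsBelow (ht.smul hK g) (fun j => ?_) 1
  rw [Pi.smul_apply, hα]
  exact hmono g (htq j)

/-- Conjugating a carried chain map by a group element gives a carried chain map. -/
theorem IsCarried.conj (hmono : ∀ (g : G) {p q : P}, p ≤ q → g • p ≤ g • q)
    (hα : ∀ (g : G) v, α (g • v) = g • α v) (hβ : ∀ (g : G) w, β (g • w) = g • β w)
    (hQ : ∀ (g : G), ∀ q ∈ Q, g • q ∈ Q) (hKG : IsInvariant G K) (hLG : IsInvariant G L)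
    {f : ∀ d, ((Fin d → V) →₀ R) →ₗ[R] ((Fin d → W) →₀ R)} (hf : IsCarried K α L β Q f) (g : G) :
    IsCarried K α L β Q
      (fun d => tupleRep R G W d g⁻¹ ∘ₗ f d ∘ₗ tupleRep R G V d g) where
  zero r := by
    simp only [LinearMap.comp_apply, tupleRep_single]
    rw [Subsingleton.elim (g • (Fin.elim0 : Fin 0 → V)) Fin.elim0, hf.zero, tupleRep_single,
      Subsingleton.elim (g⁻¹ • (Fin.elim0 : Fin 0 → W)) Fin.elim0]
  comm d c := by
    simp only [LinearMap.comp_apply, boundary_tupleRep, hf.comm]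
  carried q hq d c hc := by
    have h := chainsBelow_le_comap_tupleRep hmono hβ hLG g⁻¹ (g • q) d
      (hf.carried _ (hQ g q hq) d (chainsBelow_le_comap_tupleRep hmono hα hKG g q d hc))
    rwa [inv_smul_smul] at h

/-- Two invariant simplicial complexes that have cone families over the same set of labels have
isomorphic homology representations. -/
theorem nonempty_equiv_of_isConeFamily
    (hmono : ∀ (g : G) {p q : P}, p ≤ q → g • p ≤ g • q)
    (hα : ∀ (g : G) v, α (g • v) = g • α v) (hβ : ∀ (g : G) w, β (g • w) = g • β w)
    (hQ : ∀ (g : G), ∀ q ∈ Q, g • q ∈ Q) (hKG : IsInvariant G K) (hLG : IsInvariant G L)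
    {a : P → V} {b : P → W} (hK : IsConeFamily K α Q a) (hL : IsConeFamily L β Q b) (d : ℕ) :
    Nonempty ((reducedHomologyRep R K hKG d).Equiv (reducedHomologyRep R L hLG d)) := by
  have hf : IsCarried K α L β Q (carrierMap R α b) := isCarried_carrierMap hK hL
  have hg : IsCarried L β K α Q (carrierMap R β a) := isCarried_carrierMap hL hK
  let φ : ReducedHomology R K d →ₗ[R] ReducedHomology R L d := Subquotient.map (carrierMap R α b d)
    (hf.cycles_le_comap hK d) (hf.boundaries_le_comap hK d)
  let ψ : ReducedHomology R L d →ₗ[R] ReducedHomology R K d := Subquotient.map (carrierMap R β a d)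
    (hg.cycles_le_comap hL d) (hg.boundaries_le_comap hL d)
  refine ⟨Representation.Equiv.mk (LinearEquiv.ofLinearMap φ ψ ?_ ?_) fun g => ?_⟩
  -- Each composite and the identity are both carried by the labels, so they differ on cycles by
  -- boundaries.
  · refine Submodule.linearMap_qext _ (LinearMap.ext fun z => ?_)
    exact Subquotient.mk_eq_mk ((hf.comp hg).sub_mem_boundaries hL hL IsCarried.id d z.2)
  · refine Submodule.linearMap_qext _ (LinearMap.ext fun z => ?_)
    exact Subquotient.mk_eq_mk ((hg.comp hf).sub_mem_boundaries hK hK IsCarried.id d z.2)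
  · refine Submodule.linearMap_qext _ (LinearMap.ext fun z => ?_)
    refine Subquotient.mk_eq_mk ?_
    -- Compare `g⁻¹ f g` with `f`, both carried, and apply `g`: `f (g z) - g (f z)` is a boundary.
    have h := boundaries_le_comap hLG d g ((hf.conj hmono hα hβ hQ hKG hLG g).sub_mem_boundaries
      hK hL hf d z.2)
    rw [Submodule.mem_comap, map_sub] at h
    simp only [LinearMap.comp_apply, Representation.self_inv_apply] at h
    exact h

end Homology

end

end SimplicialHomology

/-! ### Trees and their clusters. -/

namespace KEqualTree

namespace LabelledTree

variable {n : ℕ}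

instance (T : LabelledTree n) : Finite T.tree := T.finite

/-- The set of the labels of the leaves that are descendants of `v`. -/
def cluster (T : LabelledTree n) (v : T.tree) : Set (Fin n) :=
  {i | v ≤ T.leaf i}

variable {T S : LabelledTree n}

theorem mem_cluster {v : T.tree} {i : Fin n} : i ∈ T.cluster v ↔ v ≤ T.leaf i := Iff.rfl

theorem cluster_anti {u v : T.tree} (h : u ≤ v) : T.cluster v ⊆ T.cluster u :=
  fun _ hi => h.trans hi

theorem cluster_bot : T.cluster ⊥ = Set.univ := Set.eq_univ_of_forall fun _ => bot_le

theorem exists_leaf_eq {v : T.tree} (hv : IsMax v) : ∃ i, (T.leaf i : T.tree) = v :=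
  ⟨T.leaf.symm ⟨v, hv⟩, by simp⟩

theorem leaf_injective : Function.Injective fun i => (T.leaf i : T.tree) :=
  Subtype.val_injective.comp T.leaf.injective

theorem isMax_leaf (i : Fin n) : IsMax (T.leaf i : T.tree) := (T.leaf i).2

theorem leaf_ne_bot (i : Fin n) : (T.leaf i : T.tree) ≠ ⊥ :=
  fun h => T.root_not_leaf (h ▸ T.isMax_leaf i)

theorem cluster_leaf (i : Fin n) : T.cluster (T.leaf i) = {i} := by
  ext j
  rw [mem_cluster, Set.mem_singleton_iff]
  constructor
  · exact fun h => leaf_injective ((T.isMax_leaf i).eq_of_le h).symm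
  · rintro rfl; exact le_rfl

theorem cluster_nonempty (v : T.tree) : (T.cluster v).Nonempty := by
  obtain ⟨w, hvw, hw⟩ := Set.finite_univ.exists_le_maximal (Set.mem_univ v)
  obtain ⟨i, rfl⟩ := exists_leaf_eq (isMax_iff_forall_not_lt.2 fun x hx => hw.not_prop_of_gt hx trivial)
  exact ⟨i, hvw⟩

theorem le_total_of_mem_cluster {u v : T.tree} {i : Fin n} (hu : i ∈ T.cluster u)
    (hv : i ∈ T.cluster v) : u ≤ v ∨ v ≤ u :=
  (le_total_of_directed (mem_cluster.1 hu) (mem_cluster.1 hv)).symm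

theorem cluster_laminar (u v : T.tree) : T.cluster u ⊆ T.cluster v ∨ T.cluster v ⊆ T.cluster u ∨
    Disjoint (T.cluster u) (T.cluster v) := by
  by_cases h : Disjoint (T.cluster u) (T.cluster v)
  · exact Or.inr (Or.inr h)
  · obtain ⟨i, hu, hv⟩ := Set.not_disjoint_iff.1 h
    rcases le_total_of_mem_cluster hu hv with h | h
    · exact Or.inr (Or.inl (cluster_anti h))
    · exact Or.inl (cluster_anti h)

/-- If the clusters of `u < v` agreed, every child of `u` would share a leaf with `v` and hence be
an ancestor of `v` or `v` itself. Two distinct children would then be comparable, so outdegree at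
least two is exactly what is needed. -/
theorem cluster_ssubset {u v : T.tree} (h : u < v) : T.cluster v ⊂ T.cluster u := by
  refine ⟨cluster_anti h.le, fun hsub => ?_⟩
  obtain ⟨a, b, hab, hs⟩ : ∃ a b, a ≠ b ∧ {a, b} ⊆ {w : T.tree | u ⋖ w} := by
    have h2 := T.two_le_outdegree u h.not_isMax
    obtain ⟨a, ha, b, hb, hab⟩ := (Set.one_lt_ncard (Set.toFinite _)).1 h2
    exact ⟨a, b, hab, Set.insert_subset ha (Set.singleton_subset_iff.2 hb)⟩
  have ha : u ⋖ a := hs (Set.mem_insert _ _)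
  have hb : u ⋖ b := hs (Set.mem_insert_of_mem _ rfl)
  have key : ∀ c, u ⋖ c → c ≤ v := by
    intro c hc
    obtain ⟨i, hi⟩ := T.cluster_nonempty c
    rcases le_total_of_mem_cluster hi (hsub (cluster_anti hc.le hi)) with h' | h'
    · exact h'
    · exact (hc.eq_or_eq h.le h').elim (fun e => absurd e h.ne') fun e => e.ge
  rcases le_total_of_directed (key b hb) (key a ha) with h' | h'
  · exact (hb.eq_or_eq ha.le h').elim (fun e => ha.ne e.symm) hab
  · exact (ha.eq_or_eq hb.le h').elim (fun e => hb.ne e.symm) hab.symm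

theorem cluster_subset_iff {u v : T.tree} : T.cluster u ⊆ T.cluster v ↔ v ≤ u := by
  refine ⟨fun h => ?_, cluster_anti⟩
  obtain ⟨i, hi⟩ := T.cluster_nonempty u
  rcases le_total_of_mem_cluster hi (h hi) with h' | h'
  · rcases h'.eq_or_lt with rfl | h'
    · exact le_rfl
    · exact absurd h (cluster_ssubset h').2
  · exact h'

theorem cluster_injective : Function.Injective T.cluster := fun _ _ h =>
  le_antisymm (cluster_subset_iff.1 h.ge) (cluster_subset_iff.1 h.le)

theorem cluster_ne_univ {v : T.tree} (h : v ≠ ⊥) : T.cluster v ≠ Set.univ := fun hv =>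
  h (cluster_injective (hv.trans cluster_bot.symm))

/-- A maximal non-leaf above `v` in the tree order is a preleaf, and its `k` children are leaves in
the cluster of `v`. -/
theorem le_ncard_cluster {k : ℕ} (hT : T.IsKEqual k) {v : T.tree} (hv : ¬ IsMax v) :
    k ≤ (T.cluster v).ncard := by
  obtain ⟨w, hvw, hw⟩ := (Set.toFinite {w : T.tree | ¬ IsMax w}).exists_le_maximal hv
  have : Nonempty (Fin n) := (T.cluster_nonempty v).nonempty
  rw [← (hT w hw.prop).1 hw]
  choose! f hf using fun x : T.tree => exists_leaf_eq (T := T) (v := x)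
  have hmax : ∀ x, w ⋖ x → IsMax x := fun x hx => by
    by_contra h
    exact hw.not_prop_of_gt hx.lt h
  refine Set.ncard_le_ncard_of_injOn f (fun x hx => ?_) ?_ (Set.toFinite _)
  · rw [mem_cluster, hf x (hmax x hx)]
    exact hvw.trans hx.le
  · intro x hx y hy h
    rw [← hf x (hmax x hx), ← hf y (hmax y hy), h]

/-- A tree contracts to another one if all clusters of the second are clusters of the first. -/
theorem contractsTo_of_cluster (h : ∀ w : S.tree, ∃ v : T.tree, T.cluster v = S.cluster w) :
    T.ContractsTo S := by
  choose g hg using h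
  -- Here `g` sends a vertex of `S` to the vertex of `T` with the same cluster. The contraction
  -- sends `v` to the deepest `x` with `g x ≤ v`; the candidates form a chain because they share a
  -- leaf. It is the right adjoint of `g`, and the contraction axioms are read off from the
  -- adjunction.
  have hexists : ∀ v : T.tree, ∃ w : S.tree, ∀ x : S.tree, g x ≤ v ↔ x ≤ w := by
    intro v
    have hbot : g ⊥ ≤ v := cluster_subset_iff.1 (by rw [hg, cluster_bot]; exact Set.subset_univ _)
    obtain ⟨w, hw⟩ := (Set.toFinite {x : S.tree | g x ≤ v}).exists_maximal ⟨⊥, hbot⟩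
    obtain ⟨i, hi⟩ := T.cluster_nonempty v
    have hmem : ∀ x : S.tree, g x ≤ v → i ∈ S.cluster x := fun x hx => by
      rw [← hg]; exact cluster_anti hx hi
    refine ⟨w, fun x => ⟨fun hx => ?_, fun hx => le_trans ?_ hw.prop⟩⟩
    · rcases le_total_of_mem_cluster (hmem x hx) (hmem w hw.prop) with h' | h'
      · exact h'
      · exact hw.le_of_ge hx h'
    · rw [← cluster_subset_iff, hg, hg]
      exact cluster_anti hx
  choose f hf using hexists
  have gc : GaloisConnection g f := fun x v => hf v x
  have hfg : ∀ w, f (g w) = w := fun w => by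
    refine le_antisymm ?_ (gc.le_u_l w)
    rw [← cluster_subset_iff, ← hg, ← hg, cluster_subset_iff]
    exact gc.l_u_le _
  have hleaf : ∀ i, g (S.leaf i) = T.leaf i := fun i =>
    cluster_injective (by rw [hg, cluster_leaf, cluster_leaf])
  refine ⟨f, fun w => ⟨g w, hfg w⟩, ?_, fun i => by rw [← hleaf, hfg], ?_, ?_, ?_⟩
  · have : g ⊥ = ⊥ := cluster_injective (by rw [hg, cluster_bot, cluster_bot])
    rw [← this, hfg]
  · intro v hv
    rw [or_iff_not_imp_left]
    refine fun hne => ⟨(gc.monotone_u (Order.pred_le v)).lt_of_ne hne, fun w h1 h2 => ?_⟩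
    -- A `w` strictly between the two images would have `g w < v`, so `g w` would already lie at or
    -- above the parent of `v` on the way to the root.
    refine h1.not_ge ((gc _ _).1 (Order.le_pred_of_lt (((gc _ _).2 h2.le).lt_of_ne ?_)))
    rintro rfl
    exact h2.ne (hfg w).symm
  · intro i hi
    have h1 : (T.leaf i : T.tree) ≤ Order.pred (T.leaf i : T.tree) := by
      rw [← hleaf, gc, hleaf, hi, ← hleaf, hfg]
    have h2 := Order.pred_lt_of_not_isMin
      (fun h : IsMin (T.leaf i : T.tree) => leaf_ne_bot i h.eq_bot)
    exact h2.not_ge h1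
  · intro u v huv
    -- Connected fibres: a right adjoint preserves meets.
    rw [gc.u_inf, ← huv, inf_idem]

/-- The clusters of a contraction of a tree are clusters of the tree. -/
theorem ContractsTo.exists_cluster_eq (h : T.ContractsTo S) (w : S.tree) :
    ∃ v : T.tree, T.cluster v = S.cluster w := by
  obtain ⟨f, hf⟩ := h
  have hmono : Monotone f := monotone_of_pred_le fun v hv => by
    rcases hf.edge v (fun h => hv (h ▸ isMin_bot)) with h | h
    · exact h.le
    · exact h.le
  -- The vertex sought is the top of the fibre over `w`; connectedness of the fibre turns minimal
  -- into least.
  obtain ⟨v, hv⟩ := (Set.toFinite {v : T.tree | f v = w}).exists_minimal (hf.surjective w)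
  have hle : ∀ u, f u = w → v ≤ u := fun u hu => by
    have h1 : f (v ⊓ u) = w := (hf.connected v u (hv.prop.trans hu.symm)).trans hv.prop
    exact (hv.le_of_le h1 inf_le_left).trans inf_le_right
  refine ⟨v, Set.Subset.antisymm (fun i hi => ?_) fun i hi => ?_⟩
  · rw [mem_cluster, ← hf.map_leaf, ← hv.prop]
    exact hmono hi
  · have hne : {u : T.tree | u ≤ T.leaf i ∧ w ≤ f u}.Nonempty :=
      ⟨T.leaf i, le_rfl, by rw [hf.map_leaf]; exact hi⟩
    -- Go from the leaf `i` towards the root for as long as the image stays at or beyond `w`. Each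
    -- edge moves the image by at most one step, so at the last such `u` the image is exactly `w`.
    obtain ⟨u, hu⟩ := (Set.toFinite _).exists_minimal hne
    refine (hle u ?_).trans hu.prop.1
    by_cases hb : u = ⊥
    · have h1 := hu.prop.2
      rw [hb, hf.map_root, le_bot_iff] at h1
      rw [hb, hf.map_root, h1]
    · have hlt : Order.pred u < u := Order.pred_lt_of_not_isMin fun h => hb h.eq_bot
      have hnot : ¬ w ≤ f (Order.pred u) := fun h =>
        hu.not_prop_of_lt hlt ⟨hlt.le.trans hu.prop.1, h⟩
      rcases hf.edge u hb with h | h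
      · exact absurd (h ▸ hu.prop.2) hnot
      · have h1 := (le_total_of_directed h.le hu.prop.2).resolve_left hnot
        exact ((h.eq_or_eq h1 hu.prop.2).resolve_left fun e => hnot e.le).symm

theorem contractsTo_iff :
    T.ContractsTo S ↔ ∀ w : S.tree, ∃ v : T.tree, T.cluster v = S.cluster w :=
  ⟨ContractsTo.exists_cluster_eq, contractsTo_of_cluster⟩

/-- The set of the clusters of the internal edges of a tree. -/
def edgeClusters (T : LabelledTree n) : Set (Set (Fin n)) :=
  T.cluster '' T.internalEdges

theorem eq_singleton_of_isMax {v : T.tree} (hv : IsMax v) : ∃ i, T.cluster v = {i} := by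
  obtain ⟨i, rfl⟩ := exists_leaf_eq hv
  exact ⟨i, cluster_leaf i⟩

theorem not_isMax_iff {v : T.tree} : ¬ IsMax v ↔ (T.cluster v).Nontrivial := by
  constructor
  · intro hv
    obtain ⟨i, hi⟩ := T.cluster_nonempty v
    have hlt : v < T.leaf i := lt_of_le_of_ne hi fun h => hv (h ▸ T.isMax_leaf i)
    by_contra hn
    rw [Set.not_nontrivial_iff] at hn
    have h1 := cluster_ssubset hlt
    rw [cluster_leaf] at h1
    exact h1.2 fun j hj => hn hj hi
  · intro h hv
    obtain ⟨i, hi⟩ := eq_singleton_of_isMax hv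
    rw [hi] at h
    exact Set.not_nontrivial_singleton h

theorem mem_edgeClusters {A : Set (Fin n)} :
    A ∈ T.edgeClusters ↔ A ≠ Set.univ ∧ A.Nontrivial ∧ ∃ v, T.cluster v = A := by
  constructor
  · rintro ⟨v, ⟨hb, hm⟩, rfl⟩
    exact ⟨cluster_ne_univ hb, not_isMax_iff.1 hm, v, rfl⟩
  · rintro ⟨hu, hn, v, rfl⟩
    refine ⟨v, ⟨?_, not_isMax_iff.2 hn⟩, rfl⟩
    rintro rfl
    exact hu cluster_bot

/-- The root and the leaves have the same clusters in every tree, so only internal edges matter. -/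
theorem contractsTo_iff_edgeClusters_subset :
    T.ContractsTo S ↔ S.edgeClusters ⊆ T.edgeClusters := by
  rw [contractsTo_iff]
  constructor
  · intro h A hA
    rw [mem_edgeClusters] at hA ⊢
    obtain ⟨hu, hn, w, rfl⟩ := hA
    exact ⟨hu, hn, h w⟩
  · intro h w
    by_cases hb : w = ⊥
    · exact ⟨⊥, by rw [hb, cluster_bot, cluster_bot]⟩
    by_cases hm : IsMax w
    · obtain ⟨i, rfl⟩ := exists_leaf_eq hm
      exact ⟨T.leaf i, by rw [cluster_leaf, cluster_leaf]⟩
    · exact (mem_edgeClusters.1 (h ⟨w, ⟨hb, hm⟩, rfl⟩)).2.2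

theorem ncard_edgeClusters : T.edgeClusters.ncard = T.internalEdges.ncard :=
  Set.ncard_image_of_injective _ cluster_injective

theorem SameType.cluster_eq (h : SameType T S) : T.edgeClusters = S.edgeClusters := by
  have key : ∀ {T S : LabelledTree n}, SameType T S → T.edgeClusters ⊆ S.edgeClusters := by
    intro T S h A hA
    obtain ⟨e, he⟩ := h
    rw [mem_edgeClusters] at hA ⊢
    obtain ⟨hu, hn, v, rfl⟩ := hA
    refine ⟨hu, hn, e v, ?_⟩
    ext i
    rw [mem_cluster, mem_cluster, ← he, e.le_iff_le]
  exact (key h).antisymm (key ((typeSetoid n).iseqv.symm h))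

theorem edgeClusters_relabel (σ : Equiv.Perm (Fin n)) :
    (T.relabel σ).edgeClusters = Set.image σ '' T.edgeClusters := by
  rw [edgeClusters, edgeClusters, Set.image_image]
  refine Set.image_congr fun v _ => ?_
  ext i
  simp only [mem_cluster, Set.mem_image_equiv]
  rfl

end LabelledTree

end KEqualTree

/-! ### Laminar families and the trees built from them. -/

namespace KEqualTree

/-- Two sets are laminar if they are nested or disjoint. -/
def Laminar {ι : Type*} (A B : Set ι) : Prop :=
  A ⊆ B ∨ B ⊆ A ∨ Disjoint A B

section Laminar

variable {ι : Type*} {A B : Set ι}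

theorem Laminar.symm (h : Laminar A B) : Laminar B A := by
  rcases h with h | h | h
  · exact Or.inr (Or.inl h)
  · exact Or.inl h
  · exact Or.inr (Or.inr h.symm)

theorem Laminar.refl (A : Set ι) : Laminar A A := Or.inl subset_rfl

theorem Laminar.nested (h : Laminar A B) {x : ι} (hA : x ∈ A) (hB : x ∈ B) : A ⊆ B ∨ B ⊆ A := by
  rcases h with h | h | h
  · exact Or.inl h
  · exact Or.inr h
  · exact absurd hB (Set.disjoint_left.1 h hA)

theorem laminar_singleton (A : Set ι) (x : ι) : Laminar A {x} := by
  by_cases hx : x ∈ A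
  · exact Or.inr (Or.inl (Set.singleton_subset_iff.2 hx))
  · exact Or.inr (Or.inr (Set.disjoint_singleton_right.2 hx))

theorem laminar_univ (A : Set ι) : Laminar A Set.univ := Or.inl (Set.subset_univ A)

end Laminar

/-- The conditions for a family of subsets to be the family of the clusters of a rooted tree. -/
structure IsTreeFamily {ι : Type*} (F : Set (Set ι)) : Prop where
  univ_mem : Set.univ ∈ F
  singleton_mem : ∀ x, {x} ∈ F
  nonempty : ∀ A ∈ F, A.Nonempty
  laminar : ∀ A ∈ F, ∀ B ∈ F, Laminar A B

namespace IsTreeFamily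

variable {ι : Type*} [Finite ι] {F : Set (Set ι)}

/-- Members through a common point form a chain. This one fact supplies both the joins and the
parents in the tree order. -/
theorem exists_least (hF : IsTreeFamily F) {S : Set (Set ι)} (hS : S ⊆ F) (hne : S.Nonempty) {x : ι}
    (hx : ∀ A ∈ S, x ∈ A) : ∃ A ∈ S, ∀ B ∈ S, A ⊆ B := by
  obtain ⟨A, hA⟩ := (Set.toFinite S).exists_minimal hne
  refine ⟨A, hA.prop, fun B hB => ?_⟩
  rcases (hF.laminar A (hS hA.prop) B (hS hB)).nested (hx A hA.prop) (hx B hB) with h | h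
  · exact h
  · exact hA.le_of_le hB h

theorem exists_sup (hF : IsTreeFamily F) (A B : F) : ∃ C : F, ∀ D : F, C ≤ D ↔ A ≤ D ∧ B ≤ D := by
  obtain ⟨x, hx⟩ := hF.nonempty A A.2
  obtain ⟨C, ⟨hC, hAC, hBC⟩, hmin⟩ := hF.exists_least (S := {C | C ∈ F ∧ A.1 ⊆ C ∧ B.1 ⊆ C})
    (fun C hC => hC.1) ⟨Set.univ, hF.univ_mem, Set.subset_univ _, Set.subset_univ _⟩
    (x := x) (fun C hC => hC.2.1 hx)
  exact ⟨⟨C, hC⟩, fun D => ⟨fun h => ⟨hAC.trans h, hBC.trans h⟩, fun h => hmin D ⟨D.2, h.1, h.2⟩⟩⟩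

theorem exists_succ (hF : IsTreeFamily F) (A : F) :
    ∃ C : F, A ≤ C ∧ (C ≤ A → IsMax A) ∧ ∀ D : F, A < D → C ≤ D := by
  by_cases hA : IsMax A
  · exact ⟨A, le_rfl, fun _ => hA, fun D hD => hD.le⟩
  · obtain ⟨x, hx⟩ := hF.nonempty A A.2
    obtain ⟨D, hD⟩ := not_isMax_iff.1 hA
    obtain ⟨C, ⟨hC, hAC⟩, hmin⟩ := hF.exists_least (S := {C | C ∈ F ∧ A.1 ⊂ C})
      (fun C hC => hC.1) ⟨D, D.2, hD⟩ (x := x) (fun C hC => hC.2.1 hx)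
    exact ⟨⟨C, hC⟩, hAC.1, fun h => absurd h hAC.2, fun D hD => hmin D ⟨D.2, hD⟩⟩

noncomputable section

/-- The rooted tree with the given family of clusters, ordered by reverse inclusion. -/
def rootedTree {n : ℕ} {F : Set (Set (Fin n))} (hF : IsTreeFamily F) : RootedTree.{0} :=
  -- Join, top and successor for inclusion become meet, root and parent in the dual order.
  letI : SemilatticeSup F :=
    { sup := fun A B => (hF.exists_sup A B).choose
      le_sup_left := fun A B => (((hF.exists_sup A B).choose_spec _).1 le_rfl).1
      le_sup_right := fun A B => (((hF.exists_sup A B).choose_spec _).1 le_rfl).2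
      sup_le := fun A B _ h h' => ((hF.exists_sup A B).choose_spec _).2 ⟨h, h'⟩ }
  letI : OrderTop F :=
    { top := ⟨Set.univ, hF.univ_mem⟩
      le_top := fun A => Set.subset_univ A.1 }
  letI : SuccOrder F :=
    { succ := fun A => (hF.exists_succ A).choose
      le_succ := fun A => (hF.exists_succ A).choose_spec.1
      max_of_succ_le := fun {A} => (hF.exists_succ A).choose_spec.2.1
      succ_le_of_lt := fun {A B} => (hF.exists_succ A).choose_spec.2.2 B }
  { α := Fᵒᵈ }

variable {n : ℕ} {F : Set (Set (Fin n))} (hF : IsTreeFamily F)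

/-- The vertex of the tree of a family given by a member of the family. -/
def node (A : Set (Fin n)) (hA : A ∈ F) : hF.rootedTree := OrderDual.toDual (⟨A, hA⟩ : F)

/-- The member of the family given by a vertex of its tree. -/
def set (v : hF.rootedTree) : Set (Fin n) := (OrderDual.ofDual v : F).1

theorem set_mem (v : hF.rootedTree) : hF.set v ∈ F := (OrderDual.ofDual v : F).2

theorem set_node (A : Set (Fin n)) (hA : A ∈ F) : hF.set (hF.node A hA) = A := rfl

theorem set_bot : hF.set ⊥ = Set.univ := rfl

theorem le_iff {u v : hF.rootedTree} : u ≤ v ↔ hF.set v ⊆ hF.set u := Iff.rfl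

theorem lt_iff {u v : hF.rootedTree} : u < v ↔ hF.set v ⊂ hF.set u := Iff.rfl

theorem set_injective : Function.Injective hF.set := fun _ _ h =>
  le_antisymm (hF.le_iff.2 h.ge) (hF.le_iff.2 h.le)

theorem isMax_iff {v : hF.rootedTree} : IsMax v ↔ ∃ i, hF.set v = {i} := by
  constructor
  · intro h
    obtain ⟨i, hi⟩ := hF.nonempty _ (hF.set_mem v)
    have h1 : v = hF.node {i} (hF.singleton_mem i) :=
      h.eq_of_le (hF.le_iff.2 (Set.singleton_subset_iff.2 hi))
    exact ⟨i, by rw [h1, set_node]⟩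
  · rintro ⟨i, hi⟩ w hw
    rw [le_iff, hi] at hw ⊢
    rw [(hF.nonempty _ (hF.set_mem w)).subset_singleton_iff.1 hw]

theorem exists_covBy {v : hF.rootedTree} {x : Fin n} (hx : x ∈ hF.set v)
    (hv : ¬ IsMax v) : ∃ w, v ⋖ w ∧ x ∈ hF.set w := by
  have hfin : Finite hF.rootedTree := inferInstanceAs (Finite F)
  have hmem : hF.node {x} (hF.singleton_mem x) ∈ {w | v < w ∧ x ∈ hF.set w} := by
    refine ⟨lt_of_le_of_ne (hF.le_iff.2 (Set.singleton_subset_iff.2 hx)) ?_, rfl⟩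
    rintro rfl
    exact hv (hF.isMax_iff.2 ⟨x, rfl⟩)
  obtain ⟨w, hw⟩ := (Set.toFinite _).exists_minimal ⟨_, hmem⟩
  refine ⟨w, ⟨hw.prop.1, fun u h1 h2 => ?_⟩, hw.prop.2⟩
  exact hw.not_prop_of_lt h2 ⟨h1, (hF.lt_iff.1 h2).1 hw.prop.2⟩

/-- The labelled tree with a given family of clusters. -/
def labelledTree (hn : 2 ≤ n) : LabelledTree n where
  tree := hF.rootedTree
  finite := inferInstanceAs (Finite F)
  leaf := Equiv.ofBijective
    (fun i => ⟨hF.node {i} (hF.singleton_mem i), hF.isMax_iff.2 ⟨i, rfl⟩⟩) <| by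
      constructor
      · intro i j h
        have h1 := congrArg (fun v => hF.set v.1) h
        exact Set.singleton_injective h1
      · rintro ⟨v, hv⟩
        obtain ⟨i, hi⟩ := hF.isMax_iff.1 hv
        exact ⟨i, Subtype.ext (hF.set_injective hi.symm)⟩
  root_not_leaf := by
    rw [isMax_iff, set_bot]
    rintro ⟨i, hi⟩
    have h1 : (Set.univ : Set (Fin n)).ncard = 1 := by rw [hi, Set.ncard_singleton]
    rw [Set.ncard_univ, Nat.card_eq_fintype_card, Fintype.card_fin] at h1
    omega
  two_le_outdegree v hv := by
    have hfin : Finite hF.rootedTree := inferInstanceAs (Finite F)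
    obtain ⟨x, hx⟩ := hF.nonempty _ (hF.set_mem v)
    obtain ⟨a, ha, -⟩ := hF.exists_covBy hx hv
    -- The child through `x` misses some point `y`, and the child through `y` is a second one.
    obtain ⟨y, hy, hya⟩ := Set.exists_of_ssubset (hF.lt_iff.1 ha.lt)
    obtain ⟨b, hb, hyb⟩ := hF.exists_covBy hy hv
    exact (Set.one_lt_ncard (Set.toFinite _)).2 ⟨a, ha, b, hb, fun h => hya (h ▸ hyb)⟩

theorem cluster_labelledTree (hn : 2 ≤ n) (v : (hF.labelledTree hn).tree) :
    (hF.labelledTree hn).cluster v = hF.set v := by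
  ext i
  exact Set.singleton_subset_iff

theorem edgeClusters_labelledTree (hn : 2 ≤ n) :
    (hF.labelledTree hn).edgeClusters = {A ∈ F | A ≠ Set.univ ∧ A.Nontrivial} := by
  ext A
  rw [LabelledTree.mem_edgeClusters]
  constructor
  · rintro ⟨hu, hA, v, rfl⟩
    refine ⟨?_, hu, hA⟩
    rw [cluster_labelledTree]
    exact hF.set_mem v
  · rintro ⟨hA, hu, hn'⟩
    exact ⟨hu, hn', hF.node A hA, hF.cluster_labelledTree hn _⟩

end

theorem of_laminar {ι : Type*} [Nonempty ι] {F : Set (Set ι)} (hne : ∀ A ∈ F, A.Nonempty)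
    (hl : ∀ A ∈ F, ∀ B ∈ F, Laminar A B) :
    IsTreeFamily (F ∪ insert Set.univ (Set.range fun x => {x})) where
  univ_mem := Or.inr (Or.inl rfl)
  singleton_mem x := Or.inr (Or.inr ⟨x, rfl⟩)
  nonempty := by
    rintro A (hA | rfl | ⟨x, rfl⟩)
    · exact hne A hA
    · exact Set.univ_nonempty
    · exact Set.singleton_nonempty x
  laminar := by
    rintro A hA B (hB | rfl | ⟨x, rfl⟩)
    · rcases hA with hA | rfl | ⟨x, rfl⟩
      · exact hl A hA B hB
      · exact (laminar_univ B).symm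
      · exact (laminar_singleton B x).symm
    · exact laminar_univ A
    · exact laminar_singleton A x

end IsTreeFamily

/-! ### `k`-equal trees from maximal laminar families. -/

namespace LabelledTree

variable {n : ℕ} {T : LabelledTree n}

theorem eq_of_covBy_of_mem_cluster {u a b : T.tree} (ha : u ⋖ a) (hb : u ⋖ b) {i : Fin n}
    (hia : i ∈ T.cluster a) (hib : i ∈ T.cluster b) : a = b := by
  rcases le_total_of_mem_cluster hia hib with h | h
  · exact (hb.eq_or_eq ha.le h).resolve_left ha.ne'
  · exact ((ha.eq_or_eq hb.le h).resolve_left hb.ne').symm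

theorem exists_covBy_le {u v : T.tree} (h : u < v) : ∃ w, u ⋖ w ∧ w ≤ v := by
  obtain ⟨w, hw⟩ := (Set.toFinite {w : T.tree | u < w ∧ w ≤ v}).exists_minimal ⟨v, h, le_rfl⟩
  exact ⟨w, ⟨hw.prop.1, fun x h1 h2 => hw.not_prop_of_lt h2 ⟨h1, h2.le.trans hw.prop.2⟩⟩, hw.prop.2⟩

/-- The union of the clusters of two children of a vertex is laminar with every cluster. -/
theorem laminar_union_of_covBy {u a b : T.tree} (ha : u ⋖ a) (hb : u ⋖ b) (v : T.tree) :
    Laminar (T.cluster a ∪ T.cluster b) (T.cluster v) := by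
  have key : ∀ {c}, u ⋖ c → T.cluster u ⊆ T.cluster v ∨ T.cluster v ⊆ T.cluster c ∨
      Disjoint (T.cluster c) (T.cluster v) := by
    intro c hc
    by_cases hd : Disjoint (T.cluster c) (T.cluster v)
    · exact Or.inr (Or.inr hd)
    obtain ⟨i, hi, hiv⟩ := Set.not_disjoint_iff.1 hd
    rcases le_total_of_mem_cluster hi hiv with h | h
    · exact Or.inr (Or.inl (cluster_anti h))
    rcases le_total_of_mem_cluster (cluster_anti hc.le hi) hiv with h' | h'
    · rcases hc.eq_or_eq h' h with e | e
      · exact Or.inl (e ▸ subset_rfl)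
      · exact Or.inr (Or.inl (e ▸ subset_rfl))
    · exact Or.inl (cluster_anti h')
  have hsub : T.cluster a ∪ T.cluster b ⊆ T.cluster u :=
    Set.union_subset (cluster_anti ha.le) (cluster_anti hb.le)
  rcases key ha with h | h | h
  · exact Or.inl (hsub.trans h)
  · exact Or.inr (Or.inl (h.trans Set.subset_union_left))
  rcases key hb with h' | h' | h'
  · exact Or.inl (hsub.trans h')
  · exact Or.inr (Or.inl (h'.trans Set.subset_union_right))
  · exact Or.inr (Or.inr (Set.disjoint_union_left.2 ⟨h, h'⟩))

/-- A tree whose clusters form a maximal laminar family of sets with at least `k` elements (and of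
singletons) is binary except at preleaves, where it is `k`-ary. -/
theorem isKEqual_of_maximal {k : ℕ} (hk : 2 ≤ k)
    (hcard : ∀ v : T.tree, ¬ IsMax v → k ≤ (T.cluster v).ncard)
    (hmax : ∀ C : Set (Fin n), k ≤ C.ncard → (∀ v, Laminar C (T.cluster v)) →
      ∃ v, T.cluster v = C) : T.IsKEqual k := by
  intro u hu
  constructor
  · intro hpre
    have hleaf : ∀ w, u < w → IsMax w := fun w hw => by
      by_contra h
      exact hpre.not_prop_of_gt hw h
    have hchild : {w : T.tree | u ⋖ w} = (fun i => (T.leaf i : T.tree)) '' T.cluster u := by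
      ext w
      constructor
      · intro hw
        obtain ⟨i, rfl⟩ := exists_leaf_eq (hleaf w hw.lt)
        exact ⟨i, hw.le, rfl⟩
      · rintro ⟨i, hi, rfl⟩
        refine ⟨lt_of_le_of_ne hi fun h => hu (h ▸ T.isMax_leaf i), fun x h1 h2 => ?_⟩
        exact (hleaf x h1).not_lt h2
    rw [hchild, Set.ncard_image_of_injective _ leaf_injective]
    -- Beyond a preleaf there are only singletons, so any `k`-element subset of its cluster is
    -- laminar with all clusters. By maximality it is a cluster, and having `k ≥ 2` elements it can
    -- only be the cluster of `u`.
    obtain ⟨C, hCu, hC⟩ := Set.exists_subset_card_eq (hcard u hu)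
    obtain ⟨v, hv⟩ := hmax C hC.ge fun v => by
      rcases T.cluster_laminar u v with h | h | h
      · exact Or.inl (hCu.trans h)
      · rcases (cluster_subset_iff.1 h).eq_or_lt with rfl | h'
        · exact Or.inl hCu
        · obtain ⟨i, hi⟩ := eq_singleton_of_isMax (hleaf v h')
          rw [hi]
          exact laminar_singleton C i
      · exact Or.inr (Or.inr (h.mono_left hCu))
    have huv : u ≤ v := by rwa [← cluster_subset_iff, hv]
    rcases huv.eq_or_lt with rfl | h'
    · rw [hv, hC]
    · obtain ⟨i, hi⟩ := eq_singleton_of_isMax (hleaf v h')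
      rw [← hv, hi, Set.ncard_singleton] at hC
      omega
  · intro hpre
    obtain ⟨v, huv, hv⟩ : ∃ v, u < v ∧ ¬ IsMax v := by
      by_contra! h
      exact hpre ⟨hu, fun w hw huw => by
        rcases huw.eq_or_lt with rfl | h'
        · exact le_rfl
        · exact absurd (h w h') hw⟩
    -- The child `a` is taken on the way to a non-leaf, so its cluster has at least `k` elements.
    -- Merging it with another child `b` gives a laminar set, hence a cluster; it exceeds that of
    -- `a`, so it is the cluster of `u`, leaving no room for a third child.
    obtain ⟨a, ha, hav⟩ := exists_covBy_le huv
    have ham : ¬ IsMax a := fun h => hv (h.eq_of_le hav ▸ h)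
    obtain ⟨i, hiu, hia⟩ := Set.exists_of_ssubset (cluster_ssubset ha.lt)
    have hlt : u < T.leaf i := lt_of_le_of_ne hiu fun h => hu (h ▸ T.isMax_leaf i)
    obtain ⟨b, hb, hbi⟩ := exists_covBy_le hlt
    obtain ⟨w, hw⟩ := hmax (T.cluster a ∪ T.cluster b)
      ((hcard a ham).trans (Set.ncard_le_ncard Set.subset_union_left (Set.toFinite _)))
      (laminar_union_of_covBy ha hb)
    have huw : u ≤ w := by
      rw [← cluster_subset_iff, hw]
      exact Set.union_subset (cluster_anti ha.le) (cluster_anti hb.le)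
    have hwa : w ≤ a := by
      rw [← cluster_subset_iff, hw]
      exact Set.subset_union_left
    have hwu : w = u := (ha.eq_or_eq huw hwa).resolve_right fun h =>
      hia (by rw [← h, hw]; exact Or.inr hbi)
    rw [hwu] at hw
    have hchild : {w : T.tree | u ⋖ w} = {a, b} := by
      ext c
      constructor
      · intro hc
        obtain ⟨j, hj⟩ := T.cluster_nonempty c
        rcases hw.le (cluster_anti hc.le hj) with h | h
        · exact Or.inl (eq_of_covBy_of_mem_cluster hc ha hj h)
        · exact Or.inr (eq_of_covBy_of_mem_cluster hc hb hj h)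
      · rintro (rfl | rfl)
        · exact ha
        · exact hb
    rw [hchild, Set.ncard_pair]
    rintro rfl
    exact hia hbi

/-- Every laminar family of proper subsets with at least `k` elements consists of clusters of a tree
that is binary except at preleaves, where it is `k`-ary. -/
theorem exists_isKEqual {k : ℕ} (hk : 2 ≤ k) (hkn : k ≤ n) {F : Set (Set (Fin n))}
    (hcard : ∀ A ∈ F, k ≤ A.ncard) (hu : Set.univ ∉ F)
    (hl : ∀ A ∈ F, ∀ B ∈ F, Laminar A B) :
    ∃ T : LabelledTree n, T.IsKEqual k ∧ F ⊆ T.edgeClusters := by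
  have hn : 2 ≤ n := hk.trans hkn
  have : Nonempty (Fin n) := ⟨⟨0, by omega⟩⟩
  have hnt : ∀ A : Set (Fin n), k ≤ A.ncard → A.Nontrivial := fun A hA =>
    (Set.one_lt_ncard_iff_nontrivial).1 (by omega)
  let F₀ : Set (Set (Fin n)) := F ∪ insert Set.univ (Set.range fun x => {x})
  -- Add the whole set and the singletons, then enlarge to a maximal tree family whose nontrivial
  -- members have at least `k` elements.
  obtain ⟨M, hFM, hM⟩ := (Set.toFinite {M : Set (Set (Fin n)) |
      IsTreeFamily M ∧ ∀ A ∈ M, A.Nontrivial → k ≤ A.ncard}).exists_le_maximal (a := F₀)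
    ⟨IsTreeFamily.of_laminar (fun A hA => (hnt A (hcard A hA)).nonempty) hl, by
      rintro A (hA | rfl | ⟨x, rfl⟩) h
      · exact hcard A hA
      · rwa [Set.ncard_univ, Nat.card_eq_fintype_card, Fintype.card_fin]
      · exact absurd h Set.not_nontrivial_singleton⟩
  have hMF := hM.prop.1
  refine ⟨hMF.labelledTree hn, isKEqual_of_maximal hk (fun v hv => ?_) (fun C hC hlam => ?_), ?_⟩
  · rw [not_isMax_iff] at hv
    refine hM.prop.2 _ ?_ hv
    rw [hMF.cluster_labelledTree hn]
    exact hMF.set_mem v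
  · have hlam' : ∀ A ∈ M, Laminar C A := fun A hA => by
      have h : (hMF.labelledTree hn).cluster (hMF.node A hA) = A := hMF.cluster_labelledTree hn _
      exact h ▸ hlam (hMF.node A hA)
    have hCM : C ∈ M := by
      refine hM.le_of_ge (y := insert C M) ⟨⟨Or.inr hMF.univ_mem,
        fun x => Or.inr (hMF.singleton_mem x), ?_, ?_⟩, ?_⟩ (Set.subset_insert C M)
        (Set.mem_insert C M)
      · rintro A (rfl | hA)
        · exact (hnt A hC).nonempty
        · exact hMF.nonempty A hA
      · rintro A (rfl | hA) B (rfl | hB)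
        · exact Laminar.refl _
        · exact hlam' B hB
        · exact (hlam' A hA).symm
        · exact hMF.laminar A hA B hB
      · rintro A (rfl | hA) h
        · exact hC
        · exact hM.prop.2 A hA h
    exact ⟨hMF.node C hCM, hMF.cluster_labelledTree hn _⟩
  · intro A hA
    rw [hMF.edgeClusters_labelledTree hn]
    exact ⟨hFM (Or.inl hA), fun h => hu (h ▸ hA), hnt A (hcard A hA)⟩

/-- Every nontrivial proper subset is the cluster of the internal edge of a tree with one internal
edge. -/
theorem exists_edgeClusters_eq_singleton {A : Set (Fin n)} (hA : A.Nontrivial)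
    (hu : A ≠ Set.univ) : ∃ T : LabelledTree n, T.edgeClusters = {A} := by
  have : Nonempty (Fin n) := hA.nonempty.nonempty
  have hn : 2 ≤ n := by
    have h1 := Set.one_lt_ncard_iff_nontrivial.2 hA
    have h2 := Set.ncard_le_card A
    rw [Nat.card_eq_fintype_card, Fintype.card_fin] at h2
    omega
  have hF : IsTreeFamily ({A} ∪ insert Set.univ (Set.range fun x : Fin n => {x})) :=
    IsTreeFamily.of_laminar (by rintro _ rfl; exact hA.nonempty)
      (by rintro _ rfl _ rfl; exact Laminar.refl _)
  refine ⟨hF.labelledTree hn, ?_⟩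
  rw [hF.edgeClusters_labelledTree hn]
  ext B
  constructor
  · rintro ⟨rfl | rfl | ⟨x, rfl⟩, h1, h2⟩
    · rfl
    · exact absurd rfl h1
    · exact absurd h2 Set.not_nontrivial_singleton
  · rintro rfl
    exact ⟨Or.inl rfl, hu, hA⟩

end LabelledTree

end KEqualTree

/-! ### Combinatorial types read through their clusters. -/

namespace KEqualTree

namespace TreeType

variable {n : ℕ}

/-- The set of the clusters of the internal edges of a combinatorial type of trees. -/
def edgeClusters (c : TreeType n) : Set (Set (Fin n)) :=
  Quotient.lift LabelledTree.edgeClusters (fun _ _ h => LabelledTree.SameType.cluster_eq h) c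

theorem edgeClusters_mk (T : LabelledTree n) :
    edgeClusters (Quotient.mk _ T) = T.edgeClusters := rfl

theorem edgeClusters_smul (σ : Equiv.Perm (Fin n)) (c : TreeType n) :
    edgeClusters (σ • c) = Set.image σ '' edgeClusters c := by
  induction c using Quotient.inductionOn with
  | h T => exact LabelledTree.edgeClusters_relabel σ

/-- From here on trees enter only through families of sets. It is never needed that a type is
determined by its clusters. -/
theorem mem_simplex_iff {T : LabelledTree n} {c : TreeType n} :
    c ∈ simplex T ↔ (edgeClusters c).ncard = 1 ∧ edgeClusters c ⊆ T.edgeClusters := by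
  constructor
  · rintro ⟨S, rfl, hS, hTS⟩
    rw [edgeClusters_mk, LabelledTree.ncard_edgeClusters]
    exact ⟨hS, LabelledTree.contractsTo_iff_edgeClusters_subset.1 hTS⟩
  · induction c using Quotient.inductionOn with
    | h S =>
      rintro ⟨hS, hTS⟩
      rw [edgeClusters_mk, LabelledTree.ncard_edgeClusters] at hS
      exact ⟨S, rfl, hS, LabelledTree.contractsTo_iff_edgeClusters_subset.2 hTS⟩

end TreeType

end KEqualTree

/-! ### The `k`-equal lattice and the two cone families. -/

namespace KEqualLattice

open KEqualTree SimplicialHomology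

variable {n k : ℕ}

/-- The partition with at most one nontrivial block `A`. -/
def block (A : Set (Fin n)) : Setoid (Fin n) where
  r x y := x = y ∨ (x ∈ A ∧ y ∈ A)
  iseqv :=
    { refl := fun _ => Or.inl rfl
      symm := by rintro x y (rfl | ⟨h, h'⟩); exacts [Or.inl rfl, Or.inr ⟨h', h⟩]
      trans := by
        rintro x y z (rfl | ⟨h, h'⟩) (rfl | ⟨h2, h3⟩)
        exacts [Or.inl rfl, Or.inr ⟨h2, h3⟩, Or.inr ⟨h, h'⟩, Or.inr ⟨h, h3⟩] }

theorem block_rel {A : Set (Fin n)} {x y : Fin n} : block A x y ↔ x = y ∨ (x ∈ A ∧ y ∈ A) := Iff.rfl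

theorem block_le_iff {A : Set (Fin n)} {π : Setoid (Fin n)} :
    block A ≤ π ↔ ∀ x ∈ A, ∀ y ∈ A, π x y := by
  constructor
  · exact fun h x hx y hy => h (Or.inr ⟨hx, hy⟩)
  · rintro h x y (rfl | ⟨hx, hy⟩)
    · exact π.refl x
    · exact h x hx y hy

theorem block_mono {A B : Set (Fin n)} (h : A ⊆ B) : block A ≤ block B :=
  block_le_iff.2 fun _ hx _ hy => Or.inr ⟨h hx, h hy⟩

theorem smul_block (σ : Equiv.Perm (Fin n)) (A : Set (Fin n)) : σ • block A = block (σ '' A) := by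
  ext x y
  rw [smul_rel, block_rel, block_rel]
  simp [Equiv.image_eq_preimage_symm, Equiv.Perm.inv_def]

theorem isSingleBlock_iff {π : Setoid (Fin n)} :
    IsSingleBlock k π ↔ ∃ A : Set (Fin n), A.ncard = k ∧ π = block A := by
  classical
  constructor
  · rintro ⟨B, hB, h⟩
    exact ⟨B, by rwa [Set.ncard_coe_finset], Setoid.ext fun x y => by
      rw [h, block_rel, Finset.mem_coe, Finset.mem_coe]⟩
  · rintro ⟨A, hA, rfl⟩
    refine ⟨A.toFinset, by rwa [← Set.ncard_eq_toFinset_card'], fun x y => ?_⟩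
    rw [block_rel, Set.mem_toFinset, Set.mem_toFinset]

theorem sSup_mem_kEqualLattice {S : Set (Setoid (Fin n))} (hS : S ⊆ kEqualLattice n k) :
    sSup S ∈ kEqualLattice n k := by
  have hS' : ∀ π ∈ S, ∃ A : Set (Setoid (Fin n)), (∀ ρ ∈ A, IsSingleBlock k ρ) ∧ sSup A = π :=
    fun _ hπ => hS hπ
  choose! A hA hAS using hS'
  refine ⟨⋃ π ∈ S, A π, fun ρ hρ => ?_, le_antisymm (sSup_le fun ρ hρ => ?_)
    (sSup_le fun π hπ => ?_)⟩
  · obtain ⟨π, hπ, hρ⟩ := Set.mem_iUnion₂.1 hρ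
    exact hA π hπ ρ hρ
  · obtain ⟨π, hπ, hρ⟩ := Set.mem_iUnion₂.1 hρ
    exact (le_sSup hρ).trans ((hAS π hπ).le.trans (le_sSup hπ))
  · rw [← hAS π hπ]
    exact sSup_le_sSup fun ρ hρ => Set.mem_iUnion₂.2 ⟨π, hπ, hρ⟩

/-- Since `k ≥ 2`, any two elements of `A` lie in a common `k`-subset of `A`, so the blocks of these
subsets already join to `block A`. -/
theorem block_mem_kEqualLattice (hk : 2 ≤ k) {A : Set (Fin n)} (hA : k ≤ A.ncard) :
    block A ∈ kEqualLattice n k := by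
  refine ⟨{π | ∃ C ⊆ A, C.ncard = k ∧ π = block C}, ?_, le_antisymm (sSup_le ?_) ?_⟩
  · rintro _ ⟨C, -, hC, rfl⟩
    exact isSingleBlock_iff.2 ⟨C, hC, rfl⟩
  · rintro _ ⟨C, hCA, -, rfl⟩
    exact block_mono hCA
  · refine block_le_iff.2 fun x hx y hy => ?_
    have hxy : ({x, y} : Set (Fin n)) ⊆ A :=
      Set.insert_subset hx (Set.singleton_subset_iff.2 hy)
    obtain ⟨C, hC1, hC2, hC⟩ := Set.exists_subsuperset_card_eq hxy
      ((Set.ncard_insert_le x {y}).trans (by rw [Set.ncard_singleton]; exact hk)) hA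
    have hle : block C ≤ sSup {π | ∃ C ⊆ A, C.ncard = k ∧ π = block C} :=
      le_sSup ⟨C, hC2, hC, rfl⟩
    exact hle (Or.inr ⟨hC1 (Or.inl rfl), hC1 (Or.inr rfl)⟩)

/-- The join of the partitions given by a nonempty laminar family of proper subsets with at least
`k` elements belongs to the proper part of the `k`-equal lattice. -/
theorem sSup_block_mem_properPart (hk : 2 ≤ k) {F : Set (Set (Fin n))} (hne : F.Nonempty)
    (hcard : ∀ A ∈ F, k ≤ A.ncard) (hu : Set.univ ∉ F)
    (hl : ∀ A ∈ F, ∀ B ∈ F, Laminar A B) : sSup (block '' F) ∈ properPart n k := by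
  have hnt : ∀ A ∈ F, A.Nontrivial := fun A hA =>
    Set.one_lt_ncard_iff_nontrivial.1 (hk.trans (hcard A hA))
  refine ⟨sSup_mem_kEqualLattice ?_, fun h => ?_, fun h => ?_⟩
  · rintro _ ⟨A, hA, rfl⟩
    exact block_mem_kEqualLattice hk (hcard A hA)
  · obtain ⟨A, hA⟩ := hne
    obtain ⟨x, hx, y, hy, hxy⟩ := hnt A hA
    have hle : block A ≤ ⊥ := h ▸ le_sSup ⟨A, hA, rfl⟩
    exact hxy (hle (Or.inr ⟨hx, hy⟩))
  -- Lying in a common member of `F` is transitive by laminarity, so the join is below `r`. If it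
  -- were `⊤`, a point of a maximal member and a point outside it would share a member,
  -- contradicting maximality.
  · let r : Setoid (Fin n) :=
      { r := fun x y => x = y ∨ ∃ A ∈ F, x ∈ A ∧ y ∈ A
        iseqv :=
          { refl := fun _ => Or.inl rfl
            symm := by
              rintro x y (rfl | ⟨A, hA, hx, hy⟩)
              exacts [Or.inl rfl, Or.inr ⟨A, hA, hy, hx⟩]
            trans := by
              rintro x y z (rfl | ⟨A, hA, hx, hy⟩) (rfl | ⟨B, hB, hy', hz⟩)
              · exact Or.inl rfl
              · exact Or.inr ⟨B, hB, hy', hz⟩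
              · exact Or.inr ⟨A, hA, hx, hy⟩
              · rcases (hl A hA B hB).nested hy hy' with h | h
                · exact Or.inr ⟨B, hB, h hx, hz⟩
                · exact Or.inr ⟨A, hA, hx, h hz⟩ } }
    have hr : ⊤ ≤ r := by
      rw [← h]
      refine sSup_le ?_
      rintro _ ⟨A, hA, rfl⟩
      exact block_le_iff.2 fun x hx y hy => Or.inr ⟨A, hA, hx, hy⟩
    obtain ⟨A, hA⟩ := (Set.toFinite F).exists_maximal hne
    obtain ⟨x, hx⟩ := (hnt A hA.prop).nonempty
    obtain ⟨y, hy⟩ := (Set.ne_univ_iff_exists_notMem A).1 fun h => hu (h ▸ hA.prop)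
    rcases hr (x := x) (y := y) trivial with rfl | ⟨B, hB, hxB, hyB⟩
    · exact hy hx
    · rcases (hl A hA.prop B hB).nested hx hxB with h | h
      · exact hy (hA.le_of_ge hB h hyB)
      · exact hy (h hyB)

/-- An element of the proper part of the `k`-equal lattice has a proper block with at least `k`
elements. -/
theorem exists_block_of_mem_properPart {π : Setoid (Fin n)} (hπ : π ∈ properPart n k) :
    ∃ x, k ≤ {y | π x y}.ncard ∧ {y | π x y} ≠ Set.univ := by
  obtain ⟨⟨A, hA, rfl⟩, hb, ht⟩ := hπ
  obtain ⟨ρ, hρ, hne⟩ : ∃ ρ ∈ A, ρ ≠ ⊥ := by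
    by_contra! h
    exact hb (le_bot_iff.1 (sSup_le fun ρ hρ => (h ρ hρ).le))
  obtain ⟨B, hB, rfl⟩ := isSingleBlock_iff.1 (hA ρ hρ)
  have hle : block B ≤ sSup A := le_sSup hρ
  obtain ⟨x, hx⟩ : B.Nonempty := by
    by_contra h
    rw [Set.not_nonempty_iff_eq_empty] at h
    exact hne (le_bot_iff.1 (block_le_iff.2 fun x hx => by simp [h] at hx))
  refine ⟨x, ?_, fun h => ht ?_⟩
  · rw [← hB]
    exact Set.ncard_le_ncard (fun y hy => hle (Or.inr ⟨hx, hy⟩)) (Set.toFinite _)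
  · refine top_le_iff.1 fun y z _ => ?_
    have hy : y ∈ {y | sSup A x y} := h ▸ Set.mem_univ y
    have hz : z ∈ {y | sSup A x y} := h ▸ Set.mem_univ z
    exact (sSup A).trans ((sSup A).symm hy) hz

/-- The partition associated with a combinatorial type of trees: the join of the partitions given
by the clusters of its internal edges. -/
def partition (c : TreeType n) : Setoid (Fin n) := sSup (block '' TreeType.edgeClusters c)

theorem partition_le_iff {c : TreeType n} {π : Setoid (Fin n)} :
    partition c ≤ π ↔ ∀ A ∈ TreeType.edgeClusters c, block A ≤ π := by
  rw [partition, sSup_le_iff, Set.forall_mem_image]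

theorem partition_smul (σ : Equiv.Perm (Fin n)) (c : TreeType n) :
    partition (σ • c) = σ • partition c := by
  refine eq_of_forall_ge_iff fun π => ?_
  rw [smul_le_iff, partition_le_iff, partition_le_iff, TreeType.edgeClusters_smul,
    Set.forall_mem_image]
  refine forall₂_congr fun A _ => ?_
  rw [← smul_block, smul_le_iff]

/-- Supplies the cone points for the tree complex. The class is an arbitrary choice, so no
equivariance can be expected of it. -/
theorem exists_apex (hk : 2 ≤ k) {π : Setoid (Fin n)} (hπ : π ∈ properPart n k) :
    ∃ (c : TreeType n) (x : Fin n), TreeType.edgeClusters c = {{y | π x y}} ∧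
      k ≤ {y | π x y}.ncard ∧ {y | π x y} ≠ Set.univ := by
  obtain ⟨x, hx, hu⟩ := exists_block_of_mem_properPart hπ
  obtain ⟨T, hT⟩ := LabelledTree.exists_edgeClusters_eq_singleton
    (Set.one_lt_ncard_iff_nontrivial.1 (hk.trans hx)) hu
  exact ⟨Quotient.mk _ T, x, hT, hx, hu⟩

theorem edgeClusters_of_isFaceTuple {d : ℕ} {t : Fin d → TreeType n}
    (ht : IsFaceTuple (kEqualTreeComplex n k) t) :
    (∀ j, (TreeType.edgeClusters (t j)).ncard = 1) ∧
      (∀ A ∈ ⋃ j, TreeType.edgeClusters (t j), k ≤ A.ncard) ∧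
      Set.univ ∉ ⋃ j, TreeType.edgeClusters (t j) ∧
      ∀ A ∈ ⋃ j, TreeType.edgeClusters (t j), ∀ B ∈ ⋃ j, TreeType.edgeClusters (t j),
        Laminar A B := by
  rcases ht with ht | ⟨s, ⟨-, T, hT, hs⟩, hst⟩
  · rw [Set.range_eq_empty_iff] at ht
    simp
  · have key : ∀ j, t j ∈ simplex T := fun j => hs (hst ▸ Set.mem_range_self j)
    have hsub : ⋃ j, TreeType.edgeClusters (t j) ⊆ T.edgeClusters :=
      Set.iUnion_subset fun j => (TreeType.mem_simplex_iff.1 (key j)).2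
    refine ⟨fun j => (TreeType.mem_simplex_iff.1 (key j)).1, fun A hA => ?_, fun h => ?_,
      fun A hA B hB => ?_⟩
    · obtain ⟨v, hv, rfl⟩ := hsub hA
      exact LabelledTree.le_ncard_cluster hT hv.2
    · exact (LabelledTree.mem_edgeClusters.1 (hsub h)).1 rfl
    · obtain ⟨v, -, rfl⟩ := hsub hA
      obtain ⟨w, -, rfl⟩ := hsub hB
      exact LabelledTree.cluster_laminar v w

/-- Converse to `edgeClusters_of_isFaceTuple` for nonempty tuples: a laminar family extends to a
`k`-equal tree, whose simplex contains all entries. -/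
theorem isFaceTuple_of_edgeClusters (hk : 2 ≤ k) (hkn : k ≤ n) {d : ℕ}
    {t : Fin (d + 1) → TreeType n} (h1 : ∀ j, (TreeType.edgeClusters (t j)).ncard = 1)
    (hcard : ∀ A ∈ ⋃ j, TreeType.edgeClusters (t j), k ≤ A.ncard)
    (hu : Set.univ ∉ ⋃ j, TreeType.edgeClusters (t j))
    (hl : ∀ A ∈ ⋃ j, TreeType.edgeClusters (t j), ∀ B ∈ ⋃ j, TreeType.edgeClusters (t j),
        Laminar A B) : IsFaceTuple (kEqualTreeComplex n k) t := by
  classical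
  obtain ⟨T, hT, hFT⟩ := LabelledTree.exists_isKEqual hk hkn hcard hu hl
  refine Or.inr ⟨Finset.univ.image t, ⟨Finset.univ_nonempty.image t, T, hT, ?_⟩, ?_⟩
  · rw [Finset.coe_image, Finset.coe_univ, Set.image_univ]
    rintro _ ⟨j, rfl⟩
    exact TreeType.mem_simplex_iff.2 ⟨h1 j, (Set.subset_iUnion _ j).trans hFT⟩
  · rw [Finset.coe_image, Finset.coe_univ, Set.image_univ]

/-- If a face has labels below `π`, each of its clusters lies inside a single class of `π`. It is
thus contained in the class chosen for the apex or disjoint from it, so adding that class keeps the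
family laminar. -/
theorem isConeFamily_kEqualTreeComplex (hk : 2 ≤ k) (hkn : k ≤ n) :
    ∃ apex : Setoid (Fin n) → TreeType n,
      IsConeFamily (kEqualTreeComplex n k) partition (properPart n k) apex := by
  -- `T₀` serves only as a default value for `apex` outside the proper part.
  obtain ⟨T₀, -⟩ := LabelledTree.exists_isKEqual hk hkn (F := ∅) (by simp) (by simp) (by simp)
  have : Nonempty (TreeType n) := ⟨Quotient.mk _ T₀⟩
  choose! apex hapex using fun π (hπ : π ∈ properPart n k) => exists_apex hk hπ
  refine ⟨apex, fun {d} t ht => ?_, fun π hπ => ?_, fun π hπ {d} t ht htπ => ?_⟩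
  · obtain ⟨h1, hcard, hu, hl⟩ := edgeClusters_of_isFaceTuple ht
    have hsup : ⨆ j, partition (t j) =
        sSup (block '' ⋃ j, TreeType.edgeClusters (t j)) := by
      simp only [partition, Set.image_iUnion, sSup_iUnion]
    rw [hsup]
    refine sSup_block_mem_properPart hk ?_ hcard hu hl
    obtain ⟨A, hA⟩ := Set.ncard_eq_one.1 (h1 0)
    exact ⟨A, Set.mem_iUnion.2 ⟨0, hA ▸ rfl⟩⟩
  · obtain ⟨x, hx, -⟩ := hapex π hπ
    rw [partition_le_iff, hx]
    rintro _ rfl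
    exact block_le_iff.2 fun y hy z hz => π.trans (π.symm hy) hz
  · obtain ⟨x, hx, hxk, hxu⟩ := hapex π hπ
    obtain ⟨h1, hcard, hu, hl⟩ := edgeClusters_of_isFaceTuple ht
    have hunion : ⋃ j, TreeType.edgeClusters
        ((Fin.cons (apex π) t : Fin (d + 1) → TreeType n) j) =
        insert {y | π x y} (⋃ j, TreeType.edgeClusters (t j)) := by
      ext A
      simp [Fin.exists_fin_succ, hx]
    have hlam : ∀ A ∈ ⋃ j, TreeType.edgeClusters (t j), Laminar {y | π x y} A := by
      intro A hA
      obtain ⟨j, hj⟩ := Set.mem_iUnion.1 hA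
      have hle := block_le_iff.1 (partition_le_iff.1 (htπ j) A hj)
      by_cases hd : Disjoint {y | π x y} A
      · exact Or.inr (Or.inr hd)
      · obtain ⟨y, hy, hyA⟩ := Set.not_disjoint_iff.1 hd
        exact Or.inr (Or.inl fun z hz => π.trans hy (hle y hyA z hz))
    refine isFaceTuple_of_edgeClusters hk hkn (fun j => ?_) ?_ ?_ ?_
    · refine Fin.cases ?_ (fun j => ?_) j
      · rw [Fin.cons_zero, hx, Set.ncard_singleton]
      · rw [Fin.cons_succ]; exact h1 j
    · rw [hunion]
      rintro A (rfl | hA)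
      · exact hxk
      · exact hcard A hA
    · rw [hunion]
      rintro (h | h)
      · exact hxu h.symm
      · exact hu h
    · rw [hunion]
      rintro A (rfl | hA) B (rfl | hB)
      · exact Laminar.refl _
      · exact hlam B hB
      · exact (hlam A hA).symm
      · exact hl A hA B hB

/-- A finite nonempty chain contains its join, and a chain bounded by `q` remains a chain once `q`
is added. -/
theorem isConeFamily_orderComplex {P : Type*} [CompleteLattice P] (S : Set P) :
    IsConeFamily (orderComplex S) id S id where
  iSup_mem {d} t ht := by
    rcases ht with ht | ⟨s, ⟨hne, hsS, hs⟩, hst⟩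
    · exact absurd ht (Set.range_nonempty t).ne_empty
    · obtain ⟨m, hm⟩ := s.finite_toSet.exists_maximal hne
      have htop : ∀ p ∈ s, p ≤ m := fun p hp => by
        rcases hs.total hp hm.prop with h | h
        · exact h
        · exact hm.le_of_ge hp h
      obtain ⟨j, rfl⟩ : m ∈ Set.range t := hst ▸ hm.prop
      have hsup : ⨆ i, id (t i) = t j := le_antisymm
        (iSup_le fun i => htop _ (by rw [← Finset.mem_coe, hst]; exact Set.mem_range_self i))
        (le_iSup t j)
      rw [hsup]
      exact hsS hm.prop
  apex_le _ _ := le_rfl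
  cons_mem q hq {d} t ht htq := by
    classical
    right
    refine ⟨insert q (Finset.univ.image t), ⟨Finset.insert_nonempty _ _, ?_, ?_⟩, ?_⟩
    all_goals rw [Finset.coe_insert, Finset.coe_image, Finset.coe_univ, Set.image_univ]
    · refine Set.insert_subset hq ?_
      rcases ht with ht | ⟨s, ⟨-, hsS, -⟩, hst⟩
      · rw [ht]; exact Set.empty_subset _
      · rwa [← hst]
    · refine IsChain.insert ?_ ?_
      · rcases ht with ht | ⟨s, ⟨-, -, hs⟩, hst⟩
        · rw [ht]; exact IsChain.empty
        · rwa [← hst]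
      · rintro _ ⟨j, rfl⟩ _
        exact Or.inr (htq j)
    · rw [id, Fin.range_cons]

end KEqualLattice

theorem mainTheorem8 (R : Type*) [CommRing R] (n k : ℕ) (hk : 2 ≤ k) (hkn : k < n) :
    ∀ d : ℕ, Nonempty
      ((SimplicialHomology.reducedHomologyRep R (KEqualTree.kEqualTreeComplex n k)
          (KEqualTree.kEqualTreeComplex_isInvariant n k) d).Equiv
        (SimplicialHomology.reducedHomologyRep R
          (KEqualLattice.orderComplex (KEqualLattice.properPart n k))
          (KEqualLattice.orderComplex_isInvariant n k) d)) := by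
  intro d
  obtain ⟨apex, hapex⟩ := KEqualLattice.isConeFamily_kEqualTreeComplex hk hkn.le
  exact SimplicialHomology.nonempty_equiv_of_isConeFamily
    (fun σ _ _ h => KEqualLattice.smul_mono σ h) KEqualLattice.partition_smul (fun _ _ => rfl)
    (fun σ _ h => KEqualLattice.smul_mem_properPart σ h) _ _ hapex
    (KEqualLattice.isConeFamily_orderComplex _) d
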